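/- Let $N\ge 1$ be an integer, $s\in(0,1)$, $T>0$, $S_T:=\mathbb{R}^N\times(0,T]$, and $$\mathcal L^s(\mathbb{R}^N):=\Big\{f:\mathbb{R}^N\to\mathbb{R}\ \text{measurable}:\ \int_{\mathbb{R}^N}\frac{|f(x)|}{1+|x|^{N+2s}}\,dx<\infty\Big\}.$$ Let $\rho\in C(\mathbb{R}^N)$ satisfy, for some $\alpha\ge 0$ and $C_0>0$, $$\rho(x)\ge C_0(1+|x|^2)^{-\alpha/2}\qquad\text{for all }x\in\mathbb{R}^N .$$ Let $\beta>0$, put $\psi(x):=(1+|x|^2)^{-\beta/2}$, and assume that one of the following conditions holds: (i) $0<\beta\le N-2s$ and $\alpha\le 2$; (ii) $N-2s<\beta<N$ and $\alpha\le 2s$; (iii) $\beta=N$ and $\alpha<2s$; (iv) $\beta>N$ and $\alpha+\beta\le 2s+N$. Let $u$ be a classical solution of the Cauchy problem $$\rho\,u_t-\Delta u+(-\Delta)^su=0\ \text{ in }S_T,\qquad u=0\ \text{ in }\mathbb{R}^N\times\{0\},$$ that is, $u\in C^2(\mathbb{R}^N\times[0,T])$, $u\in L^1\big((0,T),\mathcal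 L^s(\mathbb{R}^N)\big)$, $u(\cdot,t)\in\mathcal L^s(\mathbb{R}^N)$ for every $t\in(0,T]$, $u(x,0)=0$ for every $x\in\mathbb{R}^N$, and for every $(x,t)\in S_T$ the equation holds pointwise, where $$(-\Delta)^su(x,t)=C_{N,s}\lim_{\varepsilon\to0^+}\int_{\{|x-y|\ge\varepsilon\}}\frac{u(x,t)-u(y,t)}{|x-y|^{N+2s}}\,dy,\qquad C_{N,s}=\frac{2^{2s-1}\,2s\,\Gamma\big(\frac{N+2s}{2}\big)}{\pi^{N/2}\,\Gamma(1-s)},$$ and $u_t$ at $t=T$ is the derivative from the left. Suppose that for some real $p\ge1$ we have $|u(\cdot,t)|^p\in\mathcal L^s(\mathbb{R}^N)$ for every $t\in(0,T]$, and that $u\in L^p_\psi(S_T)$, i.e. $\int_0^T\int_{\mathbb{R}^N}|u(x,t)|^p\psi(x)\,dx\,dt<\infty$. Then $u\equiv0$ in $S_T$. -/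

import Mathlib

open MeasureTheory Filter Topology Set
open scoped ENNReal

noncomputable section

namespace MixedParabolic

/-- The space `ℝ^N` with its Euclidean norm. -/
abbrev Space (N : ℕ) : Type := EuclideanSpace ℝ (Fin N)

/-- The normalization constant `C_{N,s}` of the fractional Laplacian. -/
def fracConst (N : ℕ) (s : ℝ) : ℝ :=
  (2 ^ (2 * s - 1) * (2 * s) * Real.Gamma (((N : ℝ) + 2 * s) / 2)) /
    (Real.pi ^ ((N : ℝ) / 2) * Real.Gamma (1 - s))

/-- `(-Δ)^s f (x)` exists and equals `L`, that is, the principal value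
`C_{N,s} P.V. ∫ (f x - f y) / |x - y|^(N + 2s) dy` converges to `L`. -/
def HasFracLaplacianAt {N : ℕ} (s : ℝ) (f : Space N → ℝ) (x : Space N) (L : ℝ) : Prop :=
  Tendsto
    (fun ε : ℝ => fracConst N s *
      ∫ y in {y : Space N | ε ≤ ‖x - y‖}, (f x - f y) / ‖x - y‖ ^ ((N : ℝ) + 2 * s))
    (𝓝[>] 0) (𝓝 L)

/-- The norm `∫ |f x| / (1 + |x|^(N + 2s)) dx`, with values in `[0, ∞]`. -/
def lsNorm {N : ℕ} (s : ℝ) (f : Space N → ℝ) : ℝ≥0∞ :=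
  ∫⁻ x, ENNReal.ofReal (|f x| / (1 + ‖x‖ ^ ((N : ℝ) + 2 * s)))

/-- Membership in `𝓛^s(ℝ^N)`. -/
def MemLs {N : ℕ} (s : ℝ) (f : Space N → ℝ) : Prop :=
  AEStronglyMeasurable f volume ∧ lsNorm s f < ∞

/-- Membership in `L^1((0,T), 𝓛^s(ℝ^N))`. -/
def MemL1Ls {N : ℕ} (s T : ℝ) (u : Space N → ℝ → ℝ) : Prop :=
  AEStronglyMeasurable (fun z : Space N × ℝ => u z.1 z.2)
      (volume.restrict (univ ×ˢ Ioo 0 T)) ∧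
    ∫⁻ t in Ioo 0 T, lsNorm s (fun x => u x t) < ∞

/-- The weight `ψ_β(x) = (1 + |x|²)^(-β/2)`. -/
def psi {N : ℕ} (β : ℝ) (x : Space N) : ℝ := (1 + ‖x‖ ^ 2) ^ (-β / 2)

/-- Membership in `L^p_ψ(S_T)` for `ψ = ψ_β` and `S_T = ℝ^N × (0,T]`. -/
def MemLpPsi {N : ℕ} (p β T : ℝ) (u : Space N → ℝ → ℝ) : Prop :=
  AEStronglyMeasurable (fun z : Space N × ℝ => u z.1 z.2)
      (volume.restrict (univ ×ˢ Ioc 0 T)) ∧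
    ∫⁻ z in (univ : Set (Space N)) ×ˢ Ioc 0 T,
      ENNReal.ofReal (|u z.1 z.2| ^ p * psi β z.1) < ∞

/-- Assumption `(H₀)` on the coefficient `ρ`, with its exponent `α` and constant `C₀`. -/
structure AssumptionH0 {N : ℕ} (ρ : Space N → ℝ) (α C₀ : ℝ) : Prop where
  continuous : Continuous ρ
  alpha_nonneg : 0 ≤ α
  const_pos : 0 < C₀
  lower_bound : ∀ x, C₀ * (1 + ‖x‖ ^ 2) ^ (-α / 2) ≤ ρ x

/-- One of the four conditions relating `α`, `β`, `N` and `s` holds. -/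
def ExponentCondition (N : ℕ) (s α β : ℝ) : Prop :=
  (0 < β ∧ β ≤ N - 2 * s ∧ α ≤ 2) ∨
  (N - 2 * s < β ∧ β < N ∧ α ≤ 2 * s) ∨
  (β = N ∧ α < 2 * s) ∨
  (N < β ∧ α + β ≤ 2 * s + N)

/-- Classical solutions of `ρ u_t - Δu + (-Δ)^s u = 0` in `S_T = ℝ^N × (0,T]`.
At `t = T` the time derivative is the one from the left. -/
structure IsSolutionEquation {N : ℕ} (s T : ℝ) (ρ : Space N → ℝ) (u : Space N → ℝ → ℝ) :
    Prop where
  contDiffOn : ContDiffOn ℝ 2 (fun z : Space N × ℝ => u z.1 z.2) (univ ×ˢ Ioc 0 T)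
  memLs : ∀ t ∈ Ioc 0 T, MemLs s (fun x => u x t)
  equation : ∀ x, ∀ t ∈ Ioc 0 T, ∃ L : ℝ, HasFracLaplacianAt s (fun y => u y t) x L ∧
    ρ x * derivWithin (fun τ => u x τ) (Ioc 0 T) t
      - (Laplacian.laplacian (fun y : Space N => u y t) : Space N → ℝ) x + L = 0

/-- Classical solutions of the Cauchy problem with zero initial datum. -/
structure IsSolutionProblem {N : ℕ} (s T : ℝ) (ρ : Space N → ℝ) (u : Space N → ℝ → ℝ) :
    Prop where
  contDiffOn : ContDiffOn ℝ 2 (fun z : Space N × ℝ => u z.1 z.2) (univ ×ˢ Icc 0 T)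
  memL1Ls : MemL1Ls s T u
  solution : IsSolutionEquation s T ρ u
  initial : ∀ x, u x 0 = 0

end MixedParabolic

end

open MeasureTheory Filter Topology Set
open scoped ENNReal NNReal

noncomputable section

namespace MixedParabolic

/-! ### The weight `ψ_β` -/

section Weight

variable {N : ℕ}

/-! The proof is a weighted energy estimate for `G(u)`, where `G = profile ⌊p⌋₊` is convex, C¹, zero
only at 0 and at most `|r|^p`. Write `A = Δ - c(-Δ)^s` and multiply the equation by `φ G'(u)`, with
`φ` a cut-off at radius `R` times `ψ`. Convexity gives `G'(u) A u ≤ A G(u)`, and symmetry moves `A`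
onto `φ`. If `A φ ≤ λ ρ φ + e_R`, then `exp(-λt) ∫ ρ φ G(u(t)) ≤ ∫∫ |u|^p e_R` (`energy_le`). Since
`0 ≤ e_R ≤ B ψ` and `e_R → 0` pointwise, the assumption `u ∈ L^p_ψ` and dominated convergence send
the right side to 0 as `R → ∞`, so `G(u) = 0`.

All of this is carried out with difference quotients of step `h` and kernels truncated at `|z| ≥ h`.
At that level convexity is the tangent-line inequality, symmetry is Fubini and translation
invariance, and no regularity of `G(u)` beyond continuity is needed. The limit `h → 0` is taken only
in the term containing `A u` (`integral_test_le`), so `φ` needs just a one-sided bound uniform in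
`h` (`exists_mixed_testFun_le`).

That bound rests on `-(-Δ)^s ψ ≤ K ⟨x⟩^(-α) ψ`, uniformly over truncations. Near the diagonal,
second differences of `ψ` are small at scale `⟨x⟩`; far away, only the mass of `ψ` in the ball of
radius `|x|` can contribute (`exists_neg_nonlocal_psi_le`). This settles `N - 2s < β < N` and `β >
N`, and `β = N` follows by enlarging `β`. For `β ≤ N - 2s` one enlarges `β` to `N - 2s`, where `K =
0`: inversion in a sphere of radius `⟨x⟩` turns the truncated operator into the integral of
`|w|^(-β) - ψ(x + w)` over a centred ball, up to a positive factor, and this is nonnegative because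
`ψ` is radially decreasing (`nonlocal_psi_critical_nonneg`). -/

/-- The Japanese bracket `⟨x⟩ = (1 + |x|²)^(1/2)`. -/
def bracket (x : Space N) : ℝ := √(1 + ‖x‖ ^ 2)

lemma bracket_sq (x : Space N) : bracket x ^ 2 = 1 + ‖x‖ ^ 2 :=
  Real.sq_sqrt (by positivity)

lemma one_le_bracket (x : Space N) : 1 ≤ bracket x := by
  rw [bracket, Real.one_le_sqrt]; nlinarith [sq_nonneg ‖x‖]

lemma bracket_pos (x : Space N) : 0 < bracket x := one_pos.trans_le (one_le_bracket x)

lemma norm_le_bracket (x : Space N) : ‖x‖ ≤ bracket x :=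
  Real.le_sqrt_of_sq_le (by linarith)

lemma bracket_add_le (x z : Space N) : bracket (x + z) ≤ bracket x + ‖z‖ := by
  have h1 := norm_add_le x z
  have h2 := norm_le_bracket x
  refine Real.sqrt_le_iff.2 ⟨by have := bracket_pos x; positivity, ?_⟩
  nlinarith [bracket_sq x, norm_nonneg z, norm_nonneg (x + z), norm_nonneg x]

lemma bracket_half_le {x z : Space N} (hz : ‖z‖ ≤ bracket x / 2) :
    bracket x / 2 ≤ bracket (x + z) := by
  have := bracket_add_le (x + z) (-z)
  rw [add_neg_cancel_right, norm_neg] at this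
  linarith

lemma psi_eq_bracket (β : ℝ) (x : Space N) : psi β x = bracket x ^ (-β) := by
  rw [psi, ← bracket_sq, ← Real.rpow_natCast, ← Real.rpow_mul (bracket_pos x).le]
  congr 1; push_cast; ring

lemma psi_pos (β : ℝ) (x : Space N) : 0 < psi β x := by
  unfold psi; positivity

lemma continuous_psi (β : ℝ) : Continuous (psi β : Space N → ℝ) := by
  unfold psi
  exact (by fun_prop : Continuous fun x : Space N => 1 + ‖x‖ ^ 2).rpow_const
    fun x => Or.inl (by positivity)

lemma psi_le_one {β : ℝ} (hβ : 0 ≤ β) (x : Space N) : psi β x ≤ 1 := by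
  rw [psi_eq_bracket]
  exact Real.rpow_le_one_of_one_le_of_nonpos (one_le_bracket x) (by linarith)

lemma psi_le_psi_of_exponent_le {β β' : ℝ} (h : β ≤ β') (x : Space N) : psi β' x ≤ psi β x := by
  simp only [psi_eq_bracket]
  exact Real.rpow_le_rpow_of_exponent_le (one_le_bracket x) (by linarith)

lemma psi_le_psi_of_norm_le {β : ℝ} (hβ : 0 ≤ β) {x y : Space N} (h : ‖x‖ ≤ ‖y‖) :
    psi β y ≤ psi β x := by
  unfold psi
  exact Real.rpow_le_rpow_of_nonpos (by positivity) (by gcongr) (by linarith)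

lemma psi_le_norm_rpow {β : ℝ} (hβ : 0 ≤ β) {x : Space N} (hx : x ≠ 0) :
    psi β x ≤ ‖x‖ ^ (-β) := by
  rw [psi_eq_bracket]
  exact Real.rpow_le_rpow_of_nonpos (norm_pos_iff.2 hx) (norm_le_bracket x) (by linarith)

/-- The variable `r` will be `⟨x+z⟩²/⟨x⟩²`, which is at least `1/4` when `|z| ≤ ⟨x⟩/2`; on that
half-line the derivative is largest at the endpoint. -/
lemma exists_rpow_neg_lipschitz {b : ℝ} (hb : 0 ≤ b) :
    ∃ C, 0 ≤ C ∧ ∀ r : ℝ, 1 / 4 ≤ r → |r ^ (-b) - 1| ≤ C * |r - 1| := by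
  refine ⟨b * (1 / 4) ^ (-b - 1), by positivity, fun r hr => ?_⟩
  have := (convex_Ici (1 / 4 : ℝ)).norm_image_sub_le_of_norm_hasDerivWithin_le
    (f := fun t : ℝ => t ^ (-b)) (f' := fun t => -b * t ^ (-b - 1)) (x := 1) (y := r)
    (C := b * (1 / 4) ^ (-b - 1)) (fun t ht => ?_) (fun t ht => ?_) (by norm_num) hr
  · simpa using this
  · have ht : (0 : ℝ) < t := lt_of_lt_of_le (by norm_num) (mem_Ici.1 ht)
    exact (Real.hasDerivAt_rpow_const (Or.inl ht.ne')).hasDerivWithinAt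
  · have ht0 : (0 : ℝ) < t := lt_of_lt_of_le (by norm_num) (mem_Ici.1 ht)
    rw [norm_mul, norm_neg, Real.norm_of_nonneg hb, Real.norm_of_nonneg (by positivity)]
    exact mul_le_mul_of_nonneg_left
      (Real.rpow_le_rpow_of_nonpos (by norm_num) (mem_Ici.1 ht) (by linarith)) hb

/-- The first order Taylor expansion of `r ^ (-b)` at `1`, with quadratic remainder. -/
lemma exists_rpow_neg_taylor {b : ℝ} (hb : 0 ≤ b) :
    ∃ C, 0 ≤ C ∧ ∀ r : ℝ, 1 / 4 ≤ r → r ^ (-b) ≤ 1 - b * (r - 1) + C * (r - 1) ^ 2 := by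
  -- The derivative of `t^(-b) + b t` is `-b (t^(-(b+1)) - 1)`, so the Lipschitz bound with exponent
  -- `b + 1` supplies the second factor `|r - 1|`.
  obtain ⟨C, hC0, hC⟩ := exists_rpow_neg_lipschitz (b := b + 1) (by linarith)
  refine ⟨b * C, by positivity, fun r hr => ?_⟩
  have hsub : uIcc 1 r ⊆ Ici (1 / 4 : ℝ) := fun t ht => by
    rcases mem_uIcc.1 ht with h | h
    · exact (by norm_num : (1 / 4 : ℝ) ≤ 1).trans h.1
    · exact hr.trans h.1
  have := (convex_uIcc (1 : ℝ) r).norm_image_sub_le_of_norm_hasDerivWithin_le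
    (f := fun t : ℝ => t ^ (-b) + b * t) (f' := fun t => -b * t ^ (-b - 1) + b) (x := 1) (y := r)
    (C := b * (C * |r - 1|)) (fun t ht => ?_) (fun t ht => ?_) left_mem_uIcc right_mem_uIcc
  · have h := (le_abs_self _).trans this
    rw [Real.norm_eq_abs, mul_assoc, mul_assoc, abs_mul_abs_self] at h
    simp only [Real.one_rpow, mul_one] at h
    nlinarith
  · have ht : (0 : ℝ) < t := lt_of_lt_of_le (by norm_num) (mem_Ici.1 (hsub ht))
    have h1 := Real.hasDerivAt_rpow_const (p := -b) (Or.inl ht.ne')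
    have h2 := (hasDerivAt_id t).const_mul b
    exact ((h1.add h2).congr_deriv (by simp)).hasDerivWithinAt
  · have h := hC t (hsub ht)
    rw [neg_add'] at h
    have e : -b * t ^ (-b - 1) + b = -(b * (t ^ (-b - 1) - 1)) := by ring
    rw [e, norm_neg, norm_mul, Real.norm_of_nonneg hb, Real.norm_eq_abs]
    have := abs_sub_left_of_mem_uIcc ht
    gcongr
    exact h.trans (by gcongr)

/-- Bounds for first and second differences of `ψ_β` at scale `⟨x⟩`. -/
lemma exists_psi_difference_bounds {β : ℝ} (hβ : 0 ≤ β) :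
    ∃ C, 0 ≤ C ∧ ∀ x z : Space N, ‖z‖ ≤ bracket x / 2 →
      psi β (x + z) + psi β (x - z) - 2 * psi β x ≤
          C * psi β x * bracket x ^ (-2 : ℝ) * ‖z‖ ^ 2 ∧
        |psi β (x + z) - psi β x| ≤ C * psi β x * ‖z‖ := by
  obtain ⟨C, hC0, hC⟩ := exists_rpow_neg_taylor (b := β / 2) (by linarith)
  obtain ⟨C', hC0', hC'⟩ := exists_rpow_neg_lipschitz (b := β / 2) (by linarith)
  have key : ∀ x z : Space N, ‖z‖ ≤ bracket x / 2 → ∃ r : ℝ, 1 / 4 ≤ r ∧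
      r - 1 = (2 * inner ℝ x z + ‖z‖ ^ 2) / bracket x ^ 2 ∧
      psi β (x + z) = psi β x * r ^ (-(β / 2)) := by
    intro x z hz
    have hx := bracket_pos x
    refine ⟨bracket (x + z) ^ 2 / bracket x ^ 2, ?_, ?_, ?_⟩
    · rw [le_div_iff₀ (by positivity)]
      nlinarith [bracket_half_le hz]
    · rw [div_sub_one (by positivity), bracket_sq, norm_add_sq_real]
      congr 1; rw [bracket_sq]; ring
    · rw [psi, psi, ← bracket_sq, ← bracket_sq, Real.div_rpow (by positivity) (by positivity),
        neg_div]
      field_simp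
  -- Here 13 majorizes `25/4 + 25/4`, from the two quadratic remainders, and 3 majorizes the `5/2`
  -- of the first-order bound.
  refine ⟨13 * C + 3 * C', by positivity, fun x z hz => ?_⟩
  have hx := bracket_pos x
  have hψ := psi_pos β x
  have hin : |inner ℝ x z| ≤ bracket x * ‖z‖ :=
    (abs_real_inner_le_norm x z).trans (by gcongr; exact norm_le_bracket x)
  obtain ⟨r, hr, hr1, hr2⟩ := key x z hz
  obtain ⟨r', hr', hr1', hr2'⟩ := key x (-z) (by simpa using hz)
  rw [inner_neg_right, norm_neg] at hr1'
  rw [← sub_eq_add_neg] at hr2'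
  have hz0 := norm_nonneg z
  have hb : ∀ a : ℝ, |a| ≤ bracket x * ‖z‖ →
      |(2 * a + ‖z‖ ^ 2) / bracket x ^ 2| ≤ 5 / 2 * (‖z‖ / bracket x) := by
    intro a ha
    rw [abs_div, abs_of_pos (by positivity : 0 < bracket x ^ 2), div_le_iff₀ (by positivity)]
    have : 5 / 2 * (‖z‖ / bracket x) * bracket x ^ 2 = 5 / 2 * ‖z‖ * bracket x := by
      field_simp
    rw [this]
    refine (abs_add_le _ _).trans ?_
    rw [abs_mul, abs_of_pos two_pos, abs_of_nonneg (by positivity : 0 ≤ ‖z‖ ^ 2)]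
    nlinarith
  have h1 := hb _ hin
  have h2 := hb (-inner ℝ x z) (by rwa [abs_neg])
  rw [← hr1] at h1
  rw [mul_neg] at h2 hr1'
  rw [← hr1'] at h2
  have sq_le : ∀ a : ℝ, |a| ≤ 5 / 2 * (‖z‖ / bracket x) →
      a ^ 2 ≤ 25 / 4 * (‖z‖ ^ 2 / bracket x ^ 2) := by
    intro a ha
    rw [← sq_abs]
    calc |a| ^ 2 ≤ (5 / 2 * (‖z‖ / bracket x)) ^ 2 := by gcongr
      _ = _ := by ring
  constructor
  -- The terms in `⟨x, z⟩` cancel, leaving `2|z|²/⟨x⟩²`. It enters the Taylor bound with the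
  -- coefficient `-β/2`, so for an upper bound it can be dropped.
  · have hsum : 0 ≤ (r - 1) + (r' - 1) := by
      rw [hr1, hr1', ← add_div]
      have : 2 * inner ℝ x z + ‖z‖ ^ 2 + (-(2 * inner ℝ x z) + ‖z‖ ^ 2) = 2 * ‖z‖ ^ 2 := by ring
      rw [this]; positivity
    have e : bracket x ^ (-2 : ℝ) * ‖z‖ ^ 2 = ‖z‖ ^ 2 / bracket x ^ 2 := by
      rw [Real.rpow_neg hx.le, Real.rpow_two]; field_simp
    rw [mul_assoc, e, hr2, hr2']
    have h3 := hC r hr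
    have h4 := hC r' hr'
    have h5 := sq_le _ h1
    have h6 := sq_le _ h2
    set q := ‖z‖ ^ 2 / bracket x ^ 2
    have hq : 0 ≤ q := by positivity
    have h7 : r ^ (-(β / 2)) + r' ^ (-(β / 2)) - 2 ≤ (13 * C + 3 * C') * q := by
      nlinarith [mul_nonneg hβ hsum, mul_le_mul_of_nonneg_left h5 hC0,
        mul_le_mul_of_nonneg_left h6 hC0, mul_nonneg hC0 hq, mul_nonneg hC0' hq]
    nlinarith
  · rw [hr2, show psi β x * r ^ (-(β / 2)) - psi β x = psi β x * (r ^ (-(β / 2)) - 1) by ring,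
      abs_mul, abs_of_pos hψ]
    have h3 := hC' r hr
    have h4 : ‖z‖ / bracket x ≤ ‖z‖ := div_le_self hz0 (one_le_bracket x)
    have h5 : |r ^ (-(β / 2)) - 1| ≤ (13 * C + 3 * C') * ‖z‖ := by
      calc _ ≤ C' * |r - 1| := h3
        _ ≤ C' * (5 / 2 * ‖z‖) := by gcongr; linarith
        _ ≤ _ := by nlinarith [mul_nonneg hC0 hz0, mul_nonneg hC0' hz0]
    calc _ ≤ psi β x * ((13 * C + 3 * C') * ‖z‖) := by gcongr
      _ = _ := by ring

/-- Off the diagonal the kernel `|z|^(-ν)` maps the weight `ψ_β` to a multiple of itself. -/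
lemma exists_psi_mul_rpow_le {β ν : ℝ} (hβ : 0 ≤ β) (hβν : β ≤ ν) :
    ∃ C, 0 ≤ C ∧ ∀ x z : Space N, z ≠ 0 →
      psi β (x + z) * ‖z‖ ^ (-ν) ≤ C * psi β x * (‖z‖ ^ (-ν) + psi ν (x + z)) := by
  refine ⟨2 ^ β + 2 ^ β * 3 ^ (ν - β), by positivity, fun x z hz => ?_⟩
  have hx := bracket_pos x
  have hy := bracket_pos (x + z)
  have hz0 : 0 < ‖z‖ := norm_pos_iff.2 hz
  simp only [psi_eq_bracket]
  set X := bracket x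
  set Y := bracket (x + z)
  -- For short `z` the weights at `x` and `x + z` are comparable. For long `z`, `|z|` dominates
  -- multiples of both brackets, so `|z|^(-ν)` splits: `|z|^(-β)` yields `ψ_β(x)`, and
  -- `|z|^(-(ν-β))` completes `ψ_β(x+z)` to `ψ_ν(x+z)`.
  rcases le_total ‖z‖ (X / 2) with h | h
  · have h1 : Y ^ (-β) ≤ 2 ^ β * X ^ (-β) := by
      calc Y ^ (-β) ≤ (X / 2) ^ (-β) :=
            Real.rpow_le_rpow_of_nonpos (by positivity) (bracket_half_le h) (by linarith)
        _ = 2 ^ β * X ^ (-β) := by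
            rw [Real.div_rpow hx.le two_pos.le, Real.rpow_neg two_pos.le]; field_simp
    calc Y ^ (-β) * ‖z‖ ^ (-ν) ≤ (2 ^ β * X ^ (-β)) * ‖z‖ ^ (-ν) := by gcongr
      _ ≤ (2 ^ β + 2 ^ β * 3 ^ (ν - β)) * X ^ (-β) * (‖z‖ ^ (-ν) + Y ^ (-ν)) := by
        gcongr
        · exact le_add_of_nonneg_right (by positivity)
        · exact le_add_of_nonneg_right (by positivity)
  · have h1 : Y / 3 ≤ ‖z‖ := by have := bracket_add_le x z; linarith
    have h2 : ‖z‖ ^ (-β) ≤ 2 ^ β * X ^ (-β) := by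
      calc ‖z‖ ^ (-β) ≤ (X / 2) ^ (-β) :=
            Real.rpow_le_rpow_of_nonpos (by positivity) h (by linarith)
        _ = 2 ^ β * X ^ (-β) := by
            rw [Real.div_rpow hx.le two_pos.le, Real.rpow_neg two_pos.le]; field_simp
    have h3 : ‖z‖ ^ (-(ν - β)) ≤ 3 ^ (ν - β) * Y ^ (-(ν - β)) := by
      calc ‖z‖ ^ (-(ν - β)) ≤ (Y / 3) ^ (-(ν - β)) :=
            Real.rpow_le_rpow_of_nonpos (by positivity) h1 (by linarith)
        _ = _ := by
            rw [Real.div_rpow hy.le (by norm_num), Real.rpow_neg (by norm_num : (0:ℝ) ≤ 3)]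
            field_simp
    calc Y ^ (-β) * ‖z‖ ^ (-ν) = Y ^ (-β) * (‖z‖ ^ (-β) * ‖z‖ ^ (-(ν - β))) := by
          rw [← Real.rpow_add hz0]; congr 2; ring
      _ ≤ Y ^ (-β) * ((2 ^ β * X ^ (-β)) * (3 ^ (ν - β) * Y ^ (-(ν - β)))) := by gcongr
      _ = (2 ^ β * 3 ^ (ν - β)) * X ^ (-β) * (Y ^ (-β) * Y ^ (-(ν - β))) := by ring
      _ = (2 ^ β * 3 ^ (ν - β)) * X ^ (-β) * Y ^ (-ν) := by
          rw [← Real.rpow_add hy]; congr 2; ring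
      _ ≤ (2 ^ β + 2 ^ β * 3 ^ (ν - β)) * X ^ (-β) * (‖z‖ ^ (-ν) + Y ^ (-ν)) := by
        gcongr
        · exact le_add_of_nonneg_left (by positivity)
        · exact le_add_of_nonneg_left (by positivity)

end Weight

/-! ### Truncated kernels -/

section Kernel

variable {N : ℕ}

/-- The kernel `|z|^(-ν)` truncated to `|z| ≥ ε`. -/
def kern (ν ε : ℝ) : Space N → ℝ :=
  indicator {z | ε ≤ ‖z‖} fun z => ‖z‖ ^ (-ν)

lemma measurableSet_le_norm (ε : ℝ) : MeasurableSet {z : Space N | ε ≤ ‖z‖} :=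
  measurableSet_le measurable_const measurable_norm

lemma measurable_kern (ν ε : ℝ) : Measurable (kern ν ε : Space N → ℝ) :=
  Measurable.indicator (by fun_prop) (measurableSet_le_norm ε)

lemma kern_nonneg (ν ε : ℝ) (z : Space N) : 0 ≤ kern ν ε z :=
  indicator_nonneg (fun _ _ => by positivity) z

lemma kern_neg (ν ε : ℝ) (z : Space N) : kern ν ε (-z) = kern ν ε z := by
  simp [kern, indicator]

lemma kern_of_le {ν ε : ℝ} {z : Space N} (h : ε ≤ ‖z‖) : kern ν ε z = ‖z‖ ^ (-ν) :=
  indicator_of_mem (s := {z : Space N | ε ≤ ‖z‖}) h _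

lemma kern_of_lt {ν ε : ℝ} {z : Space N} (h : ‖z‖ < ε) : kern ν ε z = 0 :=
  indicator_of_notMem (s := {z : Space N | ε ≤ ‖z‖}) (not_le.2 h) _

lemma kern_le_rpow (ν ε : ℝ) (z : Space N) : kern ν ε z ≤ ‖z‖ ^ (-ν) :=
  indicator_le_self' (fun _ _ => by positivity) z

/-- On the support, `1 + |y| ≤ (1 + |x|) + |y - x|`, and the first summand is at most `(1 + |x|)/ε`
times `|y - x|`. The constant is explicit because it must be uniform for `x` in a bounded set. -/
lemma kern_sub_le {ν ε : ℝ} (hν : 0 ≤ ν) (hε : 0 < ε) (x y : Space N) :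
    kern ν ε (y - x) ≤ ((1 + ‖x‖) / ε + 1) ^ ν * (1 + ‖y‖) ^ (-ν) := by
  rcases lt_or_ge ‖y - x‖ ε with h | h
  · rw [kern_of_lt h]; positivity
  · rw [kern_of_le h]
    have hz : 0 < ‖y - x‖ := hε.trans_le h
    set A := (1 + ‖x‖) / ε + 1 with hA
    have hA0 : 0 < A := by positivity
    have h1 : 1 + ‖y‖ ≤ A * ‖y - x‖ := by
      have e : ‖y‖ ≤ ‖x‖ + ‖y - x‖ := by
        simpa using norm_add_le x (y - x)
      have : 1 + ‖x‖ ≤ (1 + ‖x‖) / ε * ‖y - x‖ := by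
        rw [div_mul_eq_mul_div, le_div_iff₀ hε]; gcongr
      rw [hA, add_mul]; linarith
    calc ‖y - x‖ ^ (-ν) ≤ ((1 + ‖y‖) / A) ^ (-ν) :=
          Real.rpow_le_rpow_of_nonpos (by positivity) (by rw [div_le_iff₀ hA0]; linarith)
            (by linarith)
      _ = _ := by
          rw [Real.div_rpow (by positivity) hA0.le, Real.rpow_neg hA0.le]; field_simp

lemma finrank_space : Module.finrank ℝ (Space N) = N := by simp

lemma integrable_one_add_norm_rpow {ν : ℝ} (hν : N < ν) :
    Integrable fun y : Space N => (1 + ‖y‖) ^ (-ν) :=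
  integrable_one_add_norm (by rwa [finrank_space])

lemma integrable_psi {ν : ℝ} (hν : N < ν) : Integrable (psi ν : Space N → ℝ) :=
  integrable_rpow_neg_one_add_norm_sq (by rwa [finrank_space])

lemma integrable_kern {ν ε : ℝ} (hν : N < ν) (hε : 0 < ε) :
    Integrable (kern ν ε : Space N → ℝ) := by
  refine ((integrable_one_add_norm_rpow hν).const_mul (((1 + ‖(0 : Space N)‖) / ε + 1) ^ ν)).mono'
    (measurable_kern ν ε).aestronglyMeasurable (ae_of_all _ fun y => ?_)
  rw [Real.norm_of_nonneg (kern_nonneg _ _ _)]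
  simpa using kern_sub_le ((Nat.cast_nonneg N).trans hν.le) hε 0 y

lemma integrableOn_ball_norm_rpow (hN : 1 ≤ N) {a : ℝ} (ha : -N < a) (r : ℝ) :
    IntegrableOn (fun z : Space N => ‖z‖ ^ a) (Metric.ball 0 r) := by
  refine integrableOn_ball_of_norm_le_rpow (C := 1) (α := -a) (by simpa) (by simp; linarith)
    (ae_of_all _ fun z => ?_)
    (by fun_prop : Measurable fun z : Space N => ‖z‖ ^ a).aestronglyMeasurable
  rw [Real.norm_of_nonneg (by positivity)]; simp

lemma setIntegral_ball_norm_rpow (a : ℝ) {r : ℝ} (hr : 0 < r) :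
    ∫ z in Metric.ball (0 : Space N) r, ‖z‖ ^ a =
      r ^ (N + a) * ∫ z in Metric.ball (0 : Space N) 1, ‖z‖ ^ a := by
  have h := Measure.setIntegral_comp_smul_of_pos (volume : Measure (Space N))
    (fun z : Space N => ‖z‖ ^ a) (Metric.ball (0 : Space N) 1) hr
  rw [smul_unitBall_of_pos hr, finrank_space] at h
  simp only [norm_smul, Real.norm_of_nonneg hr.le, Real.mul_rpow hr.le (norm_nonneg _),
    integral_const_mul, smul_eq_mul] at h
  rw [Real.rpow_add hr, Real.rpow_natCast, mul_assoc, h]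
  field_simp

/-- Averaging over `z ↦ -z` replaces first differences by second differences, which is how the
singular kernel is controlled uniformly in the truncation. -/
lemma integral_le_of_add_neg_le {f g : Space N → ℝ} (hf : Integrable f) (hg : Integrable g)
    (h : ∀ z, f z + f (-z) ≤ g z) : ∫ z, f z ≤ (∫ z, g z) / 2 := by
  have h1 : ∫ z, (f z + f (-z)) = 2 * ∫ z, f z := by
    rw [integral_add hf hf.comp_neg, integral_neg_eq_self f volume]; ring
  have h2 := integral_mono (hf.add hf.comp_neg) hg h
  simp only [Pi.add_apply] at h2
  linarith

/-- The truncated nonlocal operator `∫_{|z| ≥ ε} (f x - f (x + z)) |z|^(-ν) dz`. -/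
def nonlocal (ν ε : ℝ) (f : Space N → ℝ) (x : Space N) : ℝ :=
  ∫ z, (f x - f (x + z)) * kern ν ε z

/-- The part of the nonlocal operator close to the diagonal is controlled by second
differences. -/
lemma setIntegral_ball_kern_le (hN : 1 ≤ N) {ν ε r A : ℝ} (hν : ν < N + 2) (hr : 0 < r)
    (hA : 0 ≤ A) {f : Space N → ℝ} {x : Space N}
    (hint : IntegrableOn (fun z => (f (x + z) - f x) * kern ν ε z) (Metric.ball 0 r))
    (hf : ∀ z, ‖z‖ < r → f (x + z) + f (x - z) - 2 * f x ≤ A * ‖z‖ ^ 2) :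
    ∫ z in Metric.ball 0 r, (f (x + z) - f x) * kern ν ε z ≤
      A * r ^ (N + 2 - ν) * ∫ z in Metric.ball (0 : Space N) 1, ‖z‖ ^ (2 - ν) := by
  have hI := integrableOn_ball_norm_rpow hN (a := 2 - ν) (by linarith) r
  have e := setIntegral_ball_norm_rpow (N := N) (2 - ν) hr
  have hnn : 0 ≤ ∫ z in Metric.ball (0 : Space N) r, ‖z‖ ^ (2 - ν) :=
    integral_nonneg fun z => by positivity
  rw [← integrable_indicator_iff Metric.isOpen_ball.measurableSet] at hint
  have hI' := (integrable_indicator_iff Metric.isOpen_ball.measurableSet).2 (hI.const_mul A)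
  have := integral_le_of_add_neg_le hint hI' fun z => ?_
  · rw [integral_indicator Metric.isOpen_ball.measurableSet,
      integral_indicator Metric.isOpen_ball.measurableSet, integral_const_mul] at this
    rw [mul_assoc, ← add_sub_assoc] at *
    rw [← e]
    nlinarith [mul_nonneg hA hnn]
  · by_cases hz : ‖z‖ < r
    · have m : z ∈ Metric.ball (0 : Space N) r := by simpa using hz
      have m' : -z ∈ Metric.ball (0 : Space N) r := by simpa using hz
      rw [indicator_of_mem m, indicator_of_mem m', indicator_of_mem m, kern_neg,
        ← sub_eq_add_neg]
      have hk := kern_nonneg ν ε z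
      have h1 : A * (‖z‖ ^ 2 * kern ν ε z) ≤ A * ‖z‖ ^ (2 - ν) := by
        rcases eq_or_ne z 0 with rfl | h0
        · simp; positivity
        · rw [Real.rpow_sub (norm_pos_iff.2 h0), Real.rpow_two, div_eq_mul_inv,
            ← Real.rpow_neg (norm_nonneg z)]
          gcongr
          exact kern_le_rpow _ _ _
      nlinarith [mul_le_mul_of_nonneg_right (hf z hz) hk]
    · have m : z ∉ Metric.ball (0 : Space N) r := by simpa using hz
      have m' : -z ∉ Metric.ball (0 : Space N) r := by simpa using hz
      simp [indicator_of_notMem m, indicator_of_notMem m']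

lemma integrable_sub_mul_kern_of_bounded {ν ε B : ℝ} (hν : N < ν) (hε : 0 < ε)
    {f : Space N → ℝ} (hf : Continuous f) (hB : ∀ y, |f y| ≤ B) (x : Space N) :
    Integrable fun z => (f (x + z) - f x) * kern ν ε z := by
  refine (integrable_kern hν hε).bdd_mul (c := B + B) (by fun_prop) (ae_of_all _ fun z => ?_)
  exact (norm_sub_le _ _).trans (add_le_add (hB _) (hB _))

end Kernel

/-! ### The nonlocal operator applied to the weight -/

section NonlocalWeight

variable {N : ℕ}

lemma neg_nonlocal (ν ε : ℝ) (f : Space N → ℝ) (x : Space N) :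
    -nonlocal ν ε f x = ∫ z, (f (x + z) - f x) * kern ν ε z := by
  rw [nonlocal, ← integral_neg]; congr 1; ext z; ring

lemma abs_psi_le_one {β : ℝ} (hβ : 0 ≤ β) (x : Space N) : |psi β x| ≤ 1 := by
  rw [abs_of_pos (psi_pos β x)]; exact psi_le_one hβ x

lemma integrableOn_psi_ball (β r : ℝ) : IntegrableOn (psi β : Space N → ℝ) (Metric.ball 0 r) :=
  ((continuous_psi β).continuousOn.integrableOn_compact
    (isCompact_closedBall (0 : Space N) r)).mono_set Metric.ball_subset_closedBall

/-- A lower bound for the truncated operators applied to `ψ_β` in terms of the mass of `ψ_β`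
in balls. -/
lemma exists_neg_nonlocal_psi_le (hN : 1 ≤ N) {ν α β M : ℝ} (hν : N < ν) (hν' : ν < N + 2)
    (hβ : 0 ≤ β) (hα : α ≤ ν - N) (hM0 : 0 ≤ M)
    (hM : ∀ x : Space N, ∫ y in Metric.ball (0 : Space N) ‖x‖, psi β y ≤ M * bracket x ^ (ν - α - β)) :
    ∃ C, 0 ≤ C ∧ ∀ ε, 0 < ε → ∀ x : Space N,
      -nonlocal ν ε (psi β) x ≤ C * bracket x ^ (-α) * psi β x := by
  obtain ⟨C, hC0, hC⟩ := exists_psi_difference_bounds (N := N) hβ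
  set c := ∫ z in Metric.ball (0 : Space N) 1, ‖z‖ ^ (2 - ν)
  have hc : 0 ≤ c := integral_nonneg fun z => by positivity
  refine ⟨C * c + 2 ^ ν * M, by positivity, fun ε hε x => ?_⟩
  have hx := bracket_pos x
  have hψ := psi_pos β x
  set r := bracket x / 2 with hr
  have hr0 : 0 < r := by positivity
  have hint := integrable_sub_mul_kern_of_bounded hν hε (continuous_psi β) (abs_psi_le_one hβ) x
  rw [neg_nonlocal, ← integral_add_compl Metric.isOpen_ball.measurableSet hint
    (s := Metric.ball (0 : Space N) r)]
  -- The factor `⟨x⟩^(-2)` and the scaling factor `r^(N+2-ν)` combine to `⟨x⟩^(N-ν)`, which is at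
  -- most `⟨x⟩^(-α)` because `α ≤ ν - N`.
  have near : ∫ z in Metric.ball 0 r, (psi β (x + z) - psi β x) * kern ν ε z ≤
      C * c * bracket x ^ (-α) * psi β x := by
    refine (setIntegral_ball_kern_le hN hν' hr0 (A := C * psi β x * bracket x ^ (-2 : ℝ))
      (by positivity) hint.integrableOn fun z hz => (hC x z hz.le).1).trans ?_
    have h1 : r ^ (N + 2 - ν) ≤ bracket x ^ (N + 2 - ν) :=
      Real.rpow_le_rpow hr0.le (by linarith) (by linarith)
    calc C * psi β x * bracket x ^ (-2 : ℝ) * r ^ (N + 2 - ν) * c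
        ≤ C * psi β x * bracket x ^ (-2 : ℝ) * bracket x ^ (N + 2 - ν) * c := by gcongr
      _ = C * psi β x * bracket x ^ (N - ν) * c := by
          rw [mul_assoc (C * psi β x), ← Real.rpow_add hx]; congr 3; ring
      _ ≤ C * psi β x * bracket x ^ (-α) * c := by
          gcongr
          · exact one_le_bracket x
          · linarith
      _ = _ := by ring
  -- Points with `|x + z| ≥ |x|` contribute a nonpositive increment. At the others `-ψ(x)` is
  -- discarded and the kernel is at most `r^(-ν)`, which leaves the mass of a ball.
  have far : ∫ z in (Metric.ball 0 r)ᶜ, (psi β (x + z) - psi β x) * kern ν ε z ≤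
      2 ^ ν * M * bracket x ^ (-α) * psi β x := by
    set g : Space N → ℝ := (Metric.ball (0 : Space N) ‖x‖).indicator (psi β) with hg
    have hgi : Integrable g :=
      (integrable_indicator_iff Metric.isOpen_ball.measurableSet).2 (integrableOn_psi_ball β ‖x‖)
    have hg0 : ∀ y, 0 ≤ g y := fun y => indicator_nonneg (fun y _ => (psi_pos β y).le) y
    have hgx : Integrable fun z => r ^ (-ν) * g (x + z) := (hgi.comp_add_left x).const_mul _
    calc ∫ z in (Metric.ball 0 r)ᶜ, (psi β (x + z) - psi β x) * kern ν ε z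
        ≤ ∫ z in (Metric.ball 0 r)ᶜ, r ^ (-ν) * g (x + z) := by
          refine setIntegral_mono_on hint.integrableOn hgx.integrableOn
            Metric.isOpen_ball.measurableSet.compl fun z hz => ?_
          have hz' : r ≤ ‖z‖ := by simpa using hz
          have hk : kern ν ε z ≤ r ^ (-ν) := (kern_le_rpow ν ε z).trans
            (Real.rpow_le_rpow_of_nonpos hr0 hz'
              (by have := (Nat.cast_nonneg (α := ℝ) N); linarith))
          have h1 : psi β (x + z) - psi β x ≤ g (x + z) := by
            by_cases hm : x + z ∈ Metric.ball (0 : Space N) ‖x‖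
            · rw [hg, indicator_of_mem hm]; linarith
            · rw [hg, indicator_of_notMem hm]
              have : ‖x‖ ≤ ‖x + z‖ := by simpa using hm
              linarith [psi_le_psi_of_norm_le hβ this]
          calc _ ≤ g (x + z) * kern ν ε z := by gcongr; exact kern_nonneg _ _ _
            _ ≤ g (x + z) * r ^ (-ν) := by gcongr; exact hg0 _
            _ = _ := mul_comm _ _
      _ ≤ ∫ z, r ^ (-ν) * g (x + z) :=
          setIntegral_le_integral hgx (ae_of_all _ fun z => mul_nonneg (by positivity) (hg0 _))
      _ = r ^ (-ν) * ∫ y in Metric.ball (0 : Space N) ‖x‖, psi β y := by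
          rw [integral_const_mul, integral_add_left_eq_self g x, hg,
            integral_indicator Metric.isOpen_ball.measurableSet]
      _ ≤ r ^ (-ν) * (M * bracket x ^ (ν - α - β)) := by gcongr; exact hM x
      _ = 2 ^ ν * M * (bracket x ^ (-ν) * bracket x ^ (ν - α - β)) := by
          rw [hr, Real.div_rpow hx.le two_pos.le, Real.rpow_neg two_pos.le]; field_simp
      _ = _ := by
          rw [psi_eq_bracket, mul_assoc (2 ^ ν * M), ← Real.rpow_add hx, ← Real.rpow_add hx]
          congr 2; ring
  linarith

/-- Since `ψ_β ≤ |y|^(-β)`, the mass in a ball of radius `⟨x⟩` is at most a multiple of `⟨x⟩^(N-β)`,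
and `N - β ≤ ν - α - β` is exactly the assumption on `α`. -/
lemma exists_neg_nonlocal_psi_le_of_lt_dim (hN : 1 ≤ N) {ν α β : ℝ} (hν : N < ν)
    (hν' : ν < N + 2) (hβ : 0 < β) (hβN : β < N) (hα : α ≤ ν - N) :
    ∃ C, 0 ≤ C ∧ ∀ ε, 0 < ε → ∀ x : Space N,
      -nonlocal ν ε (psi β) x ≤ C * bracket x ^ (-α) * psi β x := by
  refine exists_neg_nonlocal_psi_le hN hν hν' hβ.le hα
    (M := ∫ z in Metric.ball (0 : Space N) 1, ‖z‖ ^ (-β))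
    (integral_nonneg fun z => by positivity) fun x => ?_
  have hx := bracket_pos x
  have hI := integrableOn_ball_norm_rpow hN (a := -β) (by linarith)
  calc ∫ y in Metric.ball (0 : Space N) ‖x‖, psi β y ≤ ∫ y in Metric.ball 0 (bracket x), psi β y := by
        refine setIntegral_mono_set (integrableOn_psi_ball β _)
          (ae_of_all _ fun y => (psi_pos β y).le)
          (Metric.ball_subset_ball (norm_le_bracket x)).eventuallyLE
    _ ≤ ∫ y in Metric.ball (0 : Space N) (bracket x), ‖y‖ ^ (-β) := by
        have : Nontrivial (Space N) := by
          apply Module.nontrivial_of_finrank_pos (R := ℝ); rw [finrank_space]; omega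
        refine integral_mono_ae (integrableOn_psi_ball β _) (hI _) ?_
        filter_upwards [ae_restrict_of_ae (Measure.ae_ne volume (0 : Space N))] with y hy
        exact psi_le_norm_rpow hβ.le hy
    _ = _ := by rw [setIntegral_ball_norm_rpow _ hx, mul_comm]
    _ ≤ _ := by
        gcongr
        · exact one_le_bracket x
        · linarith

/-- Here `ψ_β` has finite total mass, so a nonnegative exponent `ν - α - β` is enough. -/
lemma exists_neg_nonlocal_psi_le_of_dim_lt (hN : 1 ≤ N) {ν α β : ℝ}
    (hν' : ν < N + 2) (hβN : N < β) (hα : 0 ≤ α) (hαβ : α + β ≤ ν) :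
    ∃ C, 0 ≤ C ∧ ∀ ε, 0 < ε → ∀ x : Space N,
      -nonlocal ν ε (psi β) x ≤ C * bracket x ^ (-α) * psi β x := by
  have hN0 := Nat.cast_nonneg (α := ℝ) N
  refine exists_neg_nonlocal_psi_le hN (by linarith) hν' (by linarith) (by linarith)
    (M := ∫ z : Space N, psi β z) (integral_nonneg fun z => (psi_pos β z).le) fun x => ?_
  calc ∫ y in Metric.ball (0 : Space N) ‖x‖, psi β y ≤ ∫ y : Space N, psi β y :=
        setIntegral_le_integral (integrable_psi hβN) (ae_of_all _ fun y => (psi_pos β y).le)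
    _ = (∫ y : Space N, psi β y) * 1 := (mul_one _).symm
    _ ≤ _ := by
        gcongr
        · exact integral_nonneg fun z => (psi_pos β z).le
        · exact Real.one_le_rpow (one_le_bracket x) (by linarith)

end NonlocalWeight

/-! ### Superharmonicity of the critical weight -/

section Critical

variable {N : ℕ}

/-- Among balls of given radius, the centred one has the largest `ψ_β`-mass. -/
lemma setIntegral_psi_closedBall_le {β : ℝ} (hβ : 0 ≤ β) (x : Space N) (r : ℝ) :
    ∫ w in Metric.closedBall (0 : Space N) r, psi β (x + w) ≤
      ∫ w in Metric.closedBall (0 : Space N) r, psi β w := by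
  have hfin : ∀ y : Space N, volume (Metric.closedBall y r) ≠ ∞ := fun y =>
    measure_closedBall_lt_top.ne
  have hψ : ∀ y : Space N, IntegrableOn (psi β : Space N → ℝ) (Metric.closedBall y r) := fun y =>
    (continuous_psi β).continuousOn.integrableOn_compact (isCompact_closedBall y r)
  have hm : ∀ y : Space N, MeasurableSet (Metric.closedBall y r) := fun y =>
    Metric.isClosed_closedBall.measurableSet
  -- This is the value of `ψ_β` on the sphere `|y| = r`. Then `ψ - c` is nonnegative inside the
  -- centred ball and nonpositive outside, and subtracting `c` is harmless because the two balls
  -- have equal volume.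
  set c : ℝ := (1 + r ^ 2) ^ (-β / 2)
  have e : ∫ w in Metric.closedBall (0 : Space N) r, psi β (x + w) =
      ∫ y in Metric.closedBall x r, psi β y := by
    rw [← integral_indicator (hm _), ← integral_indicator (hm _),
      ← integral_add_left_eq_self ((Metric.closedBall x r).indicator _) x]
    congr 1; ext w
    by_cases h : ‖w‖ ≤ r
    · rw [indicator_of_mem (by simpa using h), indicator_of_mem (by simpa [dist_eq_norm] using h)]
    · rw [indicator_of_notMem (by simpa using h),
        indicator_of_notMem (by simpa [dist_eq_norm] using h)]
  have hle : ∀ y : Space N, (Metric.closedBall x r).indicator (fun y => psi β y - c) y ≤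
      (Metric.closedBall 0 r).indicator (fun y => psi β y - c) y := by
    intro y
    have hin : ‖y‖ ≤ r → 0 ≤ psi β y - c := fun h => sub_nonneg.2
      (Real.rpow_le_rpow_of_nonpos (by positivity) (by gcongr) (by linarith))
    have hout : 0 ≤ r → r < ‖y‖ → psi β y - c ≤ 0 := fun h0 h => sub_nonpos.2
      (Real.rpow_le_rpow_of_nonpos (by positivity) (by gcongr) (by linarith))
    by_cases h : ‖y‖ ≤ r
    · rw [indicator_of_mem (s := Metric.closedBall 0 r) (by simpa using h)]
      exact indicator_le' (fun _ _ => le_rfl) (fun _ _ => hin h) y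
    · rw [indicator_of_notMem (s := Metric.closedBall 0 r) (by simpa using h)]
      by_cases h' : y ∈ Metric.closedBall x r
      · rw [indicator_of_mem h']
        exact hout (dist_nonneg.trans (Metric.mem_closedBall.1 h')) (not_le.1 h)
      · rw [indicator_of_notMem h']
  have hci : ∀ y : Space N, IntegrableOn (fun y => psi β y - c) (Metric.closedBall y r) := fun y =>
    (hψ y).sub (integrableOn_const (hfin y))
  have := integral_mono ((integrable_indicator_iff (hm x)).2 (hci x))
    ((integrable_indicator_iff (hm 0)).2 (hci 0)) hle
  rw [integral_indicator (hm x), integral_indicator (hm 0),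
    integral_sub (hψ x) (integrableOn_const (hfin x)),
    integral_sub (hψ 0) (integrableOn_const (hfin 0)), setIntegral_const, setIntegral_const,
    Measure.addHaar_real_closedBall_center] at this
  rw [e]; linarith

/-- Centring the ball increases the mass of `ψ_β`, and then `ψ_β(w) ≤ |w|^(-β)`. The condition `β <
N` makes the last function integrable at 0. -/
lemma setIntegral_norm_rpow_sub_psi_nonneg (hN : 1 ≤ N) {β : ℝ} (hβ : 0 ≤ β) (hβN : β < N)
    (x : Space N) (r : ℝ) :
    0 ≤ ∫ w in Metric.closedBall (0 : Space N) r, (‖w‖ ^ (-β) - psi β (x + w)) := by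
  have h1 : IntegrableOn (fun w : Space N => ‖w‖ ^ (-β)) (Metric.closedBall 0 r) :=
    (integrableOn_ball_norm_rpow hN (by linarith) (r + 1)).mono_set
      (Metric.closedBall_subset_ball (by linarith))
  have h2 : ∀ x : Space N, IntegrableOn (fun w => psi β (x + w)) (Metric.closedBall 0 r) :=
    fun x => ((continuous_psi β).comp (continuous_const.add continuous_id)).continuousOn
      |>.integrableOn_compact (isCompact_closedBall _ r)
  have : Nontrivial (Space N) := by
    apply Module.nontrivial_of_finrank_pos (R := ℝ); rw [finrank_space]; omega
  rw [integral_sub h1 (h2 x), sub_nonneg]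
  refine (setIntegral_psi_closedBall_le hβ x r).trans ?_
  refine integral_mono_ae (by simpa [IntegrableOn, Function.comp_def] using h2 0 :
    Integrable (fun w => psi β w) _) h1 ?_
  filter_upwards [ae_restrict_of_ae (Measure.ae_ne volume (0 : Space N))] with y hy
  exact psi_le_norm_rpow hβ hy

/-- Change of variables under the inversion in the sphere of radius `R` about the origin. -/
lemma setIntegral_inversion {R ε : ℝ} (hR : 0 < R) (hε : 0 < ε) (g : Space N → ℝ) :
    ∫ z in {z : Space N | ε ≤ ‖z‖}, g z =
      ∫ w in Metric.closedBall (0 : Space N) (R ^ 2 / ε) \ {0},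
        ((R / ‖w‖) ^ 2) ^ N * g ((R / ‖w‖) ^ 2 • w) := by
  set S := Metric.closedBall (0 : Space N) (R ^ 2 / ε) \ {0}
  have hS : MeasurableSet S := Metric.isClosed_closedBall.measurableSet.diff
    (measurableSet_singleton 0)
  have hinv : ∀ w : Space N, EuclideanGeometry.inversion 0 R w = (R / ‖w‖) ^ 2 • w := by
    intro w; simp [EuclideanGeometry.inversion]
  have himg : image (EuclideanGeometry.inversion (0 : Space N) R) S = {z : Space N | ε ≤ ‖z‖} := by
    ext z
    constructor
    · rintro ⟨w, ⟨hw, hw0⟩, rfl⟩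
      have h0 : 0 < ‖w‖ := norm_pos_iff.2 (by simpa using hw0)
      rw [mem_ofPred_eq, hinv, norm_smul, Real.norm_of_nonneg (by positivity)]
      have : ‖w‖ ≤ R ^ 2 / ε := by simpa using hw
      rw [le_div_iff₀ hε] at this
      rw [div_pow, sq ‖w‖, div_mul_eq_mul_div, le_div_iff₀ (by positivity)]
      nlinarith
    · intro hz
      have hz : ε ≤ ‖z‖ := hz
      have h0 : 0 < ‖z‖ := hε.trans_le hz
      refine ⟨EuclideanGeometry.inversion 0 R z, ⟨?_, ?_⟩,
        EuclideanGeometry.inversion_inversion _ hR.ne' z⟩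
      · rw [hinv, mem_closedBall_zero_iff, norm_smul, Real.norm_of_nonneg (by positivity),
          div_pow, sq ‖z‖, div_mul_eq_mul_div, div_le_div_iff₀ (by positivity) hε]
        nlinarith [sq_nonneg R, mul_le_mul_of_nonneg_left hz (by positivity : 0 ≤ R ^ 2 * ‖z‖)]
      · rw [mem_singleton_iff, hinv, smul_eq_zero, not_or]
        exact ⟨by positivity, norm_pos_iff.1 h0⟩
  have hinj : InjOn (EuclideanGeometry.inversion (0 : Space N) R) S :=
    (EuclideanGeometry.inversion_injective _ hR.ne').injOn
  rw [← himg, integral_image_eq_integral_abs_det_fderiv_smul volume hS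
    (fun w hw => (EuclideanGeometry.hasFDerivAt_inversion (by simpa using hw.2)).hasFDerivWithinAt)
    hinj]
  refine setIntegral_congr_fun hS fun w hw => ?_
  simp only [smul_eq_mul, hinv, dist_zero_right]
  congr 1
  -- The derivative of the inversion is `(R/|w|)²` times a reflection, whose determinant is `-1`.
  rw [ContinuousLinearMap.det, ContinuousLinearMap.toLinearMap_smul, LinearMap.det_smul,
    finrank_space, abs_mul, abs_of_nonneg (by positivity : 0 ≤ ((R / ‖w‖) ^ 2) ^ N)]
  erw [Submodule.det_reflection]
  simp

/-- In the application `R = ⟨x⟩`, `t = |w|` and `Y = ⟨x+w⟩`. The relation `β + ν = 2N` is what turns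
the Jacobian power `t^(-2N)` times the kernel power `t^ν` into `t^(-β)`. -/
lemma inversion_exponents {R t Y β ν : ℝ} (hR : 0 < R) (ht : 0 < t) (hY : 0 < Y)
    (h : β + ν = 2 * N) :
    ((R / t) ^ 2) ^ N * ((R ^ (-β) - (R / t * Y) ^ (-β)) * (R ^ 2 / t) ^ (-ν)) =
      R ^ (2 * N - β - 2 * ν) * (t ^ (-β) - Y ^ (-β)) := by
  have h1 : ((R / t) ^ 2) ^ N = R ^ (2 * N : ℝ) * t ^ (-(2 * N : ℝ)) := by
    rw [← pow_mul, div_pow, Real.rpow_neg ht.le, ← div_eq_mul_inv]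
    norm_cast
  have h2 : (R ^ 2 / t) ^ (-ν) = R ^ (-(2 * ν)) * t ^ ν := by
    rw [Real.div_rpow (by positivity) ht.le, Real.rpow_neg ht.le, div_inv_eq_mul,
      ← Real.rpow_two, ← Real.rpow_mul hR.le]
    congr 2; ring
  have h3 : (R / t * Y) ^ (-β) = R ^ (-β) * t ^ β * Y ^ (-β) := by
    rw [Real.mul_rpow (by positivity) hY.le, Real.div_rpow hR.le ht.le, Real.rpow_neg ht.le,
      div_inv_eq_mul]
  have h4 : t ^ (-(2 * N : ℝ)) * t ^ ν = t ^ (-β) := by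
    rw [← Real.rpow_add ht]; congr 1; linarith
  have h5 : t ^ (-β) * t ^ β = 1 := by
    rw [← Real.rpow_add ht]; simp
  have h6 : R ^ (2 * N - β - 2 * ν) = R ^ (2 * N : ℝ) * R ^ (-β) * R ^ (-(2 * ν)) := by
    rw [← Real.rpow_add hR, ← Real.rpow_add hR]; congr 1
  rw [h1, h2, h3, h6]
  linear_combination (R ^ (2 * N : ℝ) * R ^ (-β) * R ^ (-(2 * ν))) * (1 - t ^ β * Y ^ (-β)) * h4
    - (R ^ (2 * N : ℝ) * R ^ (-β) * R ^ (-(2 * ν))) * Y ^ (-β) * h5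

/-- The weight with exponent `2N - ν` is superharmonic for every truncated operator. -/
lemma nonlocal_psi_critical_nonneg (hN : 1 ≤ N) {ν β ε : ℝ} (hν : N < ν) (hβ : 0 < β)
    (hβν : β + ν = 2 * N) (hε : 0 < ε) (x : Space N) : 0 ≤ nonlocal ν ε (psi β) x := by
  set R := bracket x with hRdef
  have hR : 0 < R := bracket_pos x
  have h1 : nonlocal ν ε (psi β) x =
      ∫ z in {z : Space N | ε ≤ ‖z‖}, (psi β x - psi β (x + z)) * ‖z‖ ^ (-ν) := by
    rw [nonlocal, ← integral_indicator (measurableSet_le_norm ε)]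
    congr 1; ext z
    simp only [kern, indicator]; split_ifs <;> simp
  rw [h1, setIntegral_inversion hR hε]
  have hS : MeasurableSet (Metric.closedBall (0 : Space N) (R ^ 2 / ε) \ {0}) :=
    Metric.isClosed_closedBall.measurableSet.diff (measurableSet_singleton 0)
  have h2 : ∫ w in Metric.closedBall (0 : Space N) (R ^ 2 / ε) \ {0},
        ((R / ‖w‖) ^ 2) ^ N * ((psi β x - psi β (x + (R / ‖w‖) ^ 2 • w)) *
          ‖(R / ‖w‖) ^ 2 • w‖ ^ (-ν)) =
      ∫ w in Metric.closedBall (0 : Space N) (R ^ 2 / ε) \ {0},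
        R ^ (2 * N - β - 2 * ν) * (‖w‖ ^ (-β) - psi β (x + w)) := by
    refine setIntegral_congr_fun hS fun w hw => ?_
    have h0 : 0 < ‖w‖ := norm_pos_iff.2 (by simpa using hw.2)
    set t := ‖w‖
    -- This Kelvin-type identity is the reason for the radius `R = ⟨x⟩`: with `R² = 1 + |x|²` the
    -- expansion of the left square is `(R/t)²` times that of `⟨x+w⟩²`.
    have hb : bracket (x + (R / t) ^ 2 • w) = R / t * bracket (x + w) := by
      have hsq : bracket (x + (R / t) ^ 2 • w) ^ 2 = (R / t * bracket (x + w)) ^ 2 := by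
        rw [mul_pow, bracket_sq, bracket_sq, norm_add_sq_real, norm_add_sq_real, norm_smul,
          inner_smul_right, Real.norm_of_nonneg (by positivity)]
        have : R ^ 2 = 1 + ‖x‖ ^ 2 := bracket_sq x
        have h3 : (1 : ℝ) + (‖x‖ ^ 2 + 2 * ((R / t) ^ 2 * inner ℝ x w) + ((R / t) ^ 2 * t) ^ 2) =
          R ^ 2 + 2 * ((R / t) ^ 2 * inner ℝ x w) + ((R / t) ^ 2 * t) ^ 2 := by rw [this]; ring
        have h4 : (1 : ℝ) + (‖x‖ ^ 2 + 2 * inner ℝ x w + t ^ 2) =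
          R ^ 2 + 2 * inner ℝ x w + t ^ 2 := by rw [this]; ring
        rw [h3, h4]; field_simp; ring
      exact (pow_left_inj₀ (bracket_pos _).le
        (mul_nonneg (by positivity) (bracket_pos _).le) two_ne_zero).1 hsq
    have hn : ‖(R / t) ^ 2 • w‖ = R ^ 2 / t := by
      rw [norm_smul, Real.norm_of_nonneg (by positivity)]; change (R / t) ^ 2 * t = _; field_simp
    beta_reduce
    rw [hn, psi_eq_bracket, psi_eq_bracket, psi_eq_bracket, hb]
    exact inversion_exponents hR h0 (bracket_pos _) hβν
  rw [h2, integral_const_mul]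
  refine mul_nonneg (by positivity) ?_
  rw [setIntegral_congr_set (t := Metric.closedBall (0 : Space N) (R ^ 2 / ε))]
  · exact setIntegral_norm_rpow_sub_psi_nonneg hN hβ.le (by linarith) x _
  · have : Nontrivial (Space N) := by
      apply Module.nontrivial_of_finrank_pos (R := ℝ); rw [finrank_space]; omega
    exact sdiff_null_ae_eq_self (measure_singleton _)

end Critical

/-! ### Cut-off functions and test functions -/

section TestFunction

variable {N : ℕ}

/-- The function `τ ↦ f(x+τz) + f(x-τz)` has derivative `(Df(x+τz) - Df(x-τz)) z`, of size at most
`2τK|z|²`; the bound follows by the mean value inequality on `[0,1]`. -/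
lemma abs_second_difference_le {f : Space N → ℝ} (hf : Differentiable ℝ f) {K : ℝ≥0}
    {s : Set (Space N)} (hs : Convex ℝ s) (hK : LipschitzOnWith K (fderiv ℝ f) s)
    {x z : Space N} (h1 : x + z ∈ s) (h2 : x - z ∈ s) :
    |f (x + z) + f (x - z) - 2 * f x| ≤ 2 * K * ‖z‖ ^ 2 := by
  have hmem : ∀ τ ∈ Icc (-1 : ℝ) 1, x + τ • z ∈ s := by
    intro τ hτ
    have := hs h1 h2 (a := (1 + τ) / 2) (b := (1 - τ) / 2) (by linarith [hτ.1])
      (by linarith [hτ.2]) (by ring)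
    convert this using 1
    module
  have hd : ∀ τ ∈ Icc (0 : ℝ) 1, HasDerivWithinAt (fun τ : ℝ => f (x + τ • z) + f (x + (-τ) • z))
      (fderiv ℝ f (x + τ • z) z - fderiv ℝ f (x + (-τ) • z) z) (Icc 0 1) τ := by
    intro τ _
    have l1 : HasDerivAt (fun τ : ℝ => x + τ • z) z τ := by
      simpa using ((hasDerivAt_id τ).smul_const z).const_add x
    have l2 : HasDerivAt (fun τ : ℝ => x + (-τ) • z) (-z) τ := by
      simpa using ((hasDerivAt_id τ).neg.smul_const z).const_add x
    have := ((hf _).hasFDerivAt.comp_hasDerivAt τ l1).add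
      ((hf _).hasFDerivAt.comp_hasDerivAt τ l2)
    exact (this.congr_deriv (by rw [map_neg, sub_eq_add_neg])).hasDerivWithinAt
  have := norm_image_sub_le_of_norm_deriv_le_segment_01' (C := 2 * K * ‖z‖ ^ 2) hd ?_
  · have e : f (x + (1 : ℝ) • z) + f (x + (-1 : ℝ) • z) - (f (x + (0 : ℝ) • z) +
        f (x + (-0 : ℝ) • z)) = f (x + z) + f (x - z) - 2 * f x := by
      simp [sub_eq_add_neg]; ring
    rwa [e] at this
  · intro τ hτ
    have a1 := hmem τ ⟨by linarith [hτ.1], hτ.2.le⟩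
    have a2 := hmem (-τ) ⟨by linarith [hτ.2], by linarith [hτ.1]⟩
    rw [← sub_apply]
    refine (ContinuousLinearMap.le_opNorm _ _).trans ?_
    have h3 := hK.dist_le_mul _ a1 _ a2
    rw [dist_eq_norm, dist_eq_norm, show x + τ • z - (x + (-τ) • z) = (2 * τ) • z by module,
      norm_smul, Real.norm_of_nonneg (by linarith [hτ.1])] at h3
    have h4 : 2 * τ * ‖z‖ ≤ 2 * ‖z‖ := by nlinarith [norm_nonneg z, hτ.2]
    calc _ ≤ (K * (2 * ‖z‖)) * ‖z‖ := by gcongr; exact h3.trans (by gcongr)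
      _ = _ := by ring

/-- A smooth cut-off function, equal to `1` on the ball of radius `R` and to `0` outside the ball
of radius `2R`. -/
def cutoff (R : ℝ) (x : Space N) : ℝ :=
  (⟨1, 2, one_pos, one_lt_two⟩ : ContDiffBump (0 : Space N)) (R⁻¹ • x)

lemma contDiff_cutoff (R : ℝ) : ContDiff ℝ 2 (cutoff R : Space N → ℝ) :=
  (ContDiffBump.contDiff _).comp (contDiff_const_smul _)

lemma cutoff_nonneg (R : ℝ) (x : Space N) : 0 ≤ cutoff R x := ContDiffBump.nonneg _

lemma cutoff_le_one (R : ℝ) (x : Space N) : cutoff R x ≤ 1 := ContDiffBump.le_one _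

lemma cutoff_eq_one {R : ℝ} (hR : 0 < R) {x : Space N} (hx : ‖x‖ ≤ R) : cutoff R x = 1 := by
  refine ContDiffBump.one_of_mem_closedBall _ ?_
  rw [mem_closedBall_zero_iff, norm_smul, norm_inv, Real.norm_of_nonneg hR.le,
    inv_mul_le_iff₀ hR]
  simpa using hx

lemma cutoff_eq_zero {R : ℝ} (hR : 0 < R) {x : Space N} (hx : 2 * R ≤ ‖x‖) : cutoff R x = 0 := by
  refine ContDiffBump.zero_of_le_dist _ ?_
  rw [dist_zero_right, norm_smul, norm_inv, Real.norm_of_nonneg hR.le, le_inv_mul_iff₀ hR]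
  linarith

lemma hasCompactSupport_cutoff {R : ℝ} (hR : 0 < R) :
    HasCompactSupport (cutoff R : Space N → ℝ) :=
  HasCompactSupport.of_support_subset_isCompact (isCompact_closedBall 0 (2 * R)) fun x hx => by
    by_contra h
    exact hx (cutoff_eq_zero hR (by simpa using (not_le.1 (by simpa using h)).le))

/-- For doubled radii no radial monotonicity of the bump is needed: the larger cut-off is already 1
wherever the smaller one can be nonzero. -/
lemma cutoff_le_cutoff {R R' : ℝ} (hR : 0 < R) (h : 2 * R ≤ R') (x : Space N) :
    cutoff R x ≤ cutoff R' x := by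
  rcases le_total ‖x‖ (2 * R) with hx | hx
  · rw [cutoff_eq_one (by linarith) (hx.trans h)]; exact cutoff_le_one _ _
  · rw [cutoff_eq_zero hR hx]; exact cutoff_nonneg _ _

lemma tendsto_cutoff (x : Space N) :
    ∀ᶠ n : ℕ in atTop, cutoff ((n : ℝ) + 1) x = 1 := by
  filter_upwards [eventually_ge_atTop ⌈‖x‖⌉₊] with n hn
  exact cutoff_eq_one (by positivity) ((Nat.ceil_le.1 hn).trans (by linarith))

/-- Everything is rescaled to `R = 1`. Second differences actually gain `R⁻²`; this is weakened to
`R⁻¹`, using `R ≥ 1`, to match the first-order bound. -/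
lemma exists_cutoff_difference_bounds :
    ∃ M, 0 ≤ M ∧ ∀ R, 1 ≤ R → ∀ x z : Space N,
      |cutoff R (x + z) - cutoff R x| ≤ M * ‖z‖ / R ∧
        |cutoff R (x + z) + cutoff R (x - z) - 2 * cutoff R x| ≤ M * ‖z‖ ^ 2 / R := by
  set f : Space N → ℝ := cutoff 1 with hf
  have hcd : ContDiff ℝ 2 f := contDiff_cutoff 1
  have hcs : HasCompactSupport f := hasCompactSupport_cutoff one_pos
  obtain ⟨K, hK⟩ := hcd.lipschitzWith_of_hasCompactSupport hcs two_ne_zero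
  obtain ⟨K', hK'⟩ := (hcd.fderiv_right (m := 1) (by norm_num)).lipschitzWith_of_hasCompactSupport
    (hcs.fderiv ℝ) one_ne_zero
  have hscale : ∀ R (x : Space N), cutoff R x = f (R⁻¹ • x) := by
    intro R x; simp [hf, cutoff]
  refine ⟨K + 2 * K', by positivity, fun R hR x z => ?_⟩
  have hR0 : 0 < R := by linarith
  have hn : ‖R⁻¹ • z‖ = ‖z‖ / R := by
    rw [norm_smul, norm_inv, Real.norm_of_nonneg hR0.le]; field_simp
  simp only [hscale, smul_add, smul_sub]
  constructor
  · have := hK.dist_le_mul (R⁻¹ • x + R⁻¹ • z) (R⁻¹ • x)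
    rw [dist_eq_norm, dist_eq_norm, add_sub_cancel_left, hn, Real.norm_eq_abs] at this
    refine this.trans ?_
    rw [mul_div_assoc]
    gcongr
    exact le_add_of_nonneg_right (by positivity)
  · have := abs_second_difference_le (hcd.differentiable two_ne_zero) convex_univ
      (hK'.lipschitzOnWith (s := univ)) (mem_univ (R⁻¹ • x + R⁻¹ • z)) (mem_univ _)
    refine this.trans ?_
    rw [hn, div_pow, mul_div_assoc]
    gcongr
    · exact le_add_of_nonneg_left (by positivity)
    · nlinarith

/-- The test function `cutoff R * ψ_β`. -/
def testFun (R β : ℝ) (x : Space N) : ℝ := cutoff R x * psi β x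

lemma testFun_nonneg (R β : ℝ) (x : Space N) : 0 ≤ testFun R β x :=
  mul_nonneg (cutoff_nonneg R x) (psi_pos β x).le

lemma continuous_testFun (R β : ℝ) : Continuous (testFun R β : Space N → ℝ) :=
  (contDiff_cutoff R).continuous.mul (continuous_psi β)

lemma hasCompactSupport_testFun {R : ℝ} (hR : 0 < R) (β : ℝ) :
    HasCompactSupport (testFun R β : Space N → ℝ) :=
  (hasCompactSupport_cutoff hR).mul_right

/-- The discrete Laplacian with step `h`. -/
def discreteLaplacian (h : ℝ) (f : Space N → ℝ) (x : Space N) : ℝ :=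
  ∑ i, (f (x + h • EuclideanSpace.basisFun (Fin N) ℝ i) +
    f (x - h • EuclideanSpace.basisFun (Fin N) ℝ i) - 2 * f x) / h ^ 2

/-- The error produced by the cut-off far from the diagonal. -/
def cutoffError (ν β R : ℝ) (x : Space N) : ℝ :=
  ∫ z, psi β (x + z) * |cutoff R (x + z) - cutoff R x| * kern ν (1 / 2) z

lemma cutoffError_nonneg (ν β R : ℝ) (x : Space N) : 0 ≤ cutoffError ν β R x :=
  integral_nonneg fun _ => mul_nonneg (mul_nonneg (psi_pos _ _).le (abs_nonneg _))
    (kern_nonneg _ _ _)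

lemma abs_cutoff_sub_le (R : ℝ) (x y : Space N) : |cutoff R x - cutoff R y| ≤ 1 := by
  rw [abs_le]
  constructor <;>
    linarith [cutoff_nonneg R x, cutoff_nonneg R y, cutoff_le_one R x, cutoff_le_one R y]

lemma integrable_cutoffError {ν β : ℝ} (hν : N < ν) (hβ : 0 ≤ β) (R : ℝ) (x : Space N) :
    Integrable fun z => psi β (x + z) * |cutoff R (x + z) - cutoff R x| * kern ν (1 / 2) z := by
  have h1 := (continuous_psi (N := N) β)
  have h2 := (contDiff_cutoff (N := N) R).continuous
  refine (integrable_kern hν one_half_pos).bdd_mul (c := 1) (by fun_prop) (ae_of_all _ fun z => ?_)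
  rw [norm_mul, Real.norm_of_nonneg (psi_pos _ _).le, Real.norm_eq_abs, abs_abs]
  exact mul_le_one₀ (psi_le_one hβ _) (abs_nonneg _) (abs_cutoff_sub_le _ _ _)

lemma measurable_cutoffError (ν β R : ℝ) : Measurable (cutoffError ν β R : Space N → ℝ) := by
  have h1 := (continuous_psi (N := N) β).measurable
  have h2 := (contDiff_cutoff (N := N) R).continuous.measurable
  have h3 := measurable_kern (N := N) ν (1 / 2)
  have : StronglyMeasurable fun p : Space N × Space N =>
      psi β (p.1 + p.2) * |cutoff R (p.1 + p.2) - cutoff R p.1| * kern ν (1 / 2) p.2 :=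
    Measurable.stronglyMeasurable (by fun_prop)
  exact this.integral_prod_right'.measurable

/-- This provides the majorant for the limit `R → ∞`. The increment of the cut-off is bounded by 1,
and `exists_psi_mul_rpow_le` extracts `ψ_β(x)`, leaving functions integrable because `ν > N`. -/
lemma exists_cutoffError_le {ν β : ℝ} (hν : N < ν) (hβ : 0 ≤ β) (hβν : β ≤ ν) :
    ∃ C, 0 ≤ C ∧ ∀ R, ∀ x : Space N, cutoffError ν β R x ≤ C * psi β x := by
  obtain ⟨C, hC0, hC⟩ := exists_psi_mul_rpow_le (N := N) hβ hβν
  have i1 := integrable_kern (N := N) hν one_half_pos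
  have i2 := integrable_psi (N := N) hν
  refine ⟨C * ((∫ z : Space N, kern ν (1 / 2) z) + ∫ z : Space N, psi ν z), ?_, fun R x => ?_⟩
  · exact mul_nonneg hC0 (add_nonneg (integral_nonneg fun z => kern_nonneg _ _ _)
      (integral_nonneg fun z => (psi_pos _ _).le))
  · have i3 := i2.comp_add_left x
    calc cutoffError ν β R x ≤ ∫ z, C * psi β x * (kern ν (1 / 2) z + psi ν (x + z)) := by
          refine integral_mono (integrable_cutoffError hν hβ R x)
            ((i1.add i3).const_mul (C * psi β x)) fun z => ?_
          beta_reduce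
          have hψ := psi_pos β x
          have hψ' := psi_pos β (x + z)
          have hψ'' := psi_pos ν (x + z)
          rcases lt_or_ge ‖z‖ (1 / 2) with hz | hz
          · rw [kern_of_lt hz]; simp; positivity
          · rw [kern_of_le hz]
            refine le_trans ?_ (hC x z (norm_pos_iff.1 (one_half_pos.trans_le hz)))
            gcongr
            exact mul_le_of_le_one_right hψ'.le (abs_cutoff_sub_le _ _ _)
      _ = _ := by
          rw [integral_const_mul, integral_add i1 i3, integral_add_left_eq_self (psi ν) x]; ring

lemma tendsto_cutoffError {ν β : ℝ} (hν : N < ν) (hβ : 0 ≤ β) (x : Space N) :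
    Tendsto (fun n : ℕ => cutoffError ν β ((n : ℝ) + 1) x) atTop (𝓝 0) := by
  have := tendsto_integral_of_dominated_convergence (kern ν (1 / 2) : Space N → ℝ)
    (F := fun (n : ℕ) (z : Space N) =>
      psi β (x + z) * |cutoff ((n : ℝ) + 1) (x + z) - cutoff ((n : ℝ) + 1) x| * kern ν (1 / 2) z)
    (f := fun _ => 0) (fun n => (integrable_cutoffError hν hβ _ x).aestronglyMeasurable)
    (integrable_kern hν one_half_pos) (fun n => ae_of_all _ fun z => ?_)
    (ae_of_all _ fun z => ?_)
  · rw [integral_zero] at this; exact this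
  · have hk := kern_nonneg ν (1 / 2) z
    rw [Real.norm_of_nonneg (mul_nonneg (mul_nonneg (psi_pos _ _).le (abs_nonneg _)) hk)]
    exact mul_le_of_le_one_left hk
      (mul_le_one₀ (psi_le_one hβ _) (abs_nonneg _) (abs_cutoff_sub_le _ _ _))
  · refine tendsto_const_nhds.congr' ?_
    filter_upwards [tendsto_cutoff x, tendsto_cutoff (x + z)] with n h1 h2
    rw [h1, h2]; simp

/-- Second differences of `ψ_β` times the increment of the cut-off are of size `|z|² / R`. -/
lemma exists_mixed_difference_bound {β : ℝ} (hβ : 0 ≤ β) :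
    ∃ C, 0 ≤ C ∧ ∀ R, 1 ≤ R → ∀ x z : Space N, ‖z‖ ≤ 1 / 2 →
      psi β (x + z) * (cutoff R (x + z) - cutoff R x) +
        psi β (x - z) * (cutoff R (x - z) - cutoff R x) ≤ C * psi β x / R * ‖z‖ ^ 2 := by
  obtain ⟨C, hC0, hC⟩ := exists_psi_difference_bounds (N := N) hβ
  obtain ⟨M, hM0, hM⟩ := exists_cutoff_difference_bounds (N := N)
  refine ⟨M + 2 * (C * M), by positivity, fun R hR x z hz => ?_⟩
  have hR0 : 0 < R := by linarith
  have hψ := psi_pos β x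
  have hzx : ‖z‖ ≤ bracket x / 2 := by linarith [one_le_bracket x]
  have a1 := (hC x z hzx).2
  have a2 := (hC x (-z) (by rwa [norm_neg])).2
  have b1 := (hM R hR x z).1
  have b2 := (hM R hR x (-z)).1
  have b3 := (le_abs_self _).trans (hM R hR x z).2
  rw [norm_neg, ← sub_eq_add_neg] at a2 b2
  -- With `ψ(x±z) = ψ(x) + (ψ(x±z) - ψ(x))` the sum becomes `ψ(x)` times a second difference of the
  -- cut-off plus two products of first differences.
  have p1 : (psi β (x + z) - psi β x) * (cutoff R (x + z) - cutoff R x) ≤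
      (C * psi β x * ‖z‖) * (M * ‖z‖ / R) := by
    refine (le_abs_self _).trans ?_
    rw [abs_mul]; gcongr
  have p2 : (psi β (x - z) - psi β x) * (cutoff R (x - z) - cutoff R x) ≤
      (C * psi β x * ‖z‖) * (M * ‖z‖ / R) := by
    refine (le_abs_self _).trans ?_
    rw [abs_mul]; gcongr
  have p3 := mul_le_mul_of_nonneg_left b3 hψ.le
  have e : (M + 2 * (C * M)) * psi β x / R * ‖z‖ ^ 2 = psi β x * (M * ‖z‖ ^ 2 / R) +
      2 * ((C * psi β x * ‖z‖) * (M * ‖z‖ / R)) := by field_simp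
  rw [e]; linarith

end TestFunction

/-! ### The mixed operator applied to the test function -/

section TestInequality

variable {N : ℕ}

/-- A discrete product rule separates the second difference of `ψ`, weighted by the cut-off, from
the mixed terms of size `1/R`. The former decays like `⟨x⟩^(-2) ψ`, whence the restriction `α ≤ 2`.
-/
lemma exists_discreteLaplacian_testFun_le {α β : ℝ} (hβ : 0 ≤ β) (hα : α ≤ 2) :
    ∃ C, 0 ≤ C ∧ ∀ R, 1 ≤ R → ∀ h, 0 < h → h ≤ 1 / 2 → ∀ x : Space N,
      discreteLaplacian h (testFun R β) x ≤
        C * bracket x ^ (-α) * testFun R β x + C * psi β x / R := by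
  obtain ⟨C, hC0, hC⟩ := exists_psi_difference_bounds (N := N) hβ
  obtain ⟨M, hM0, hM⟩ := exists_mixed_difference_bound (N := N) hβ
  refine ⟨N * (C + M), by positivity, fun R hR h h0 h1 x => ?_⟩
  have hR0 : 0 < R := by linarith
  have hψ := psi_pos β x
  have hx := bracket_pos x
  have hγ := cutoff_nonneg R x
  have hterm : ∀ i : Fin N, (testFun R β (x + h • EuclideanSpace.basisFun (Fin N) ℝ i) +
      testFun R β (x - h • EuclideanSpace.basisFun (Fin N) ℝ i) - 2 * testFun R β x) / h ^ 2 ≤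
      (C + M) * bracket x ^ (-α) * testFun R β x + (C + M) * psi β x / R := by
    intro i
    set z := h • EuclideanSpace.basisFun (Fin N) ℝ i
    have hz : ‖z‖ = h := by simp [z, norm_smul, abs_of_pos h0]
    have a1 := (hC x z (by linarith [one_le_bracket x])).1
    have a2 := hM R hR x z (by linarith)
    rw [div_le_iff₀ (by positivity)]
    rw [hz] at a1 a2
    have e : testFun R β (x + z) + testFun R β (x - z) - 2 * testFun R β x =
        cutoff R x * (psi β (x + z) + psi β (x - z) - 2 * psi β x) +
        (psi β (x + z) * (cutoff R (x + z) - cutoff R x) +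
        psi β (x - z) * (cutoff R (x - z) - cutoff R x)) := by
      simp only [testFun]; ring
    have a3 : bracket x ^ (-2 : ℝ) ≤ bracket x ^ (-α) :=
      Real.rpow_le_rpow_of_exponent_le (one_le_bracket x) (by linarith)
    have a4 : cutoff R x * (C * psi β x * bracket x ^ (-2 : ℝ) * h ^ 2) ≤
        C * bracket x ^ (-α) * testFun R β x * h ^ 2 := by
      calc _ ≤ cutoff R x * (C * psi β x * bracket x ^ (-α) * h ^ 2) := by gcongr
        _ = _ := by rw [testFun]; ring
    have a5 : 0 ≤ M * bracket x ^ (-α) * testFun R β x * h ^ 2 := by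
      have := testFun_nonneg R β x; positivity
    have a6 : 0 ≤ C * psi β x / R * h ^ 2 := by positivity
    have a7 : ((C + M) * bracket x ^ (-α) * testFun R β x + (C + M) * psi β x / R) * h ^ 2 =
      C * bracket x ^ (-α) * testFun R β x * h ^ 2 + M * bracket x ^ (-α) * testFun R β x * h ^ 2
        + C * psi β x / R * h ^ 2 + M * psi β x / R * h ^ 2 := by ring
    rw [e, a7]
    nlinarith [mul_le_mul_of_nonneg_left a1 hγ]
  calc discreteLaplacian h (testFun R β) x ≤
      ∑ _i : Fin N, ((C + M) * bracket x ^ (-α) * testFun R β x + (C + M) * psi β x / R) :=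
        Finset.sum_le_sum fun i _ => hterm i
    _ = _ := by simp; ring

/-- Freeze the cut-off at `x`: `γψ = γ(x)ψ + ψ(γ - γ(x))`. The first part inherits the bound for
`ψ`, as `γ(x) ≥ 0`. The second vanishes at `x`; it is `O(1/R)` near the diagonal and at most
`cutoffError` away from it. -/
lemma exists_neg_nonlocal_testFun_le (hN : 1 ≤ N) {ν α β K : ℝ} (hν : N < ν) (hν' : ν < N + 2)
    (hβ : 0 ≤ β)
    (hK : ∀ ε, 0 < ε → ∀ x : Space N,
      -nonlocal ν ε (psi β) x ≤ K * bracket x ^ (-α) * psi β x) :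
    ∃ C, 0 ≤ C ∧ ∀ R, 1 ≤ R → ∀ ε, 0 < ε → ε ≤ 1 / 2 → ∀ x : Space N,
      -nonlocal ν ε (testFun R β) x ≤
        K * bracket x ^ (-α) * testFun R β x + C * psi β x / R + cutoffError ν β R x := by
  obtain ⟨M, hM0, hM⟩ := exists_mixed_difference_bound (N := N) hβ
  set c := ∫ z in Metric.ball (0 : Space N) 1, ‖z‖ ^ (2 - ν)
  have hc : 0 ≤ c := integral_nonneg fun z => by positivity
  refine ⟨M * (1 / 2) ^ (N + 2 - ν) * c, by positivity, fun R hR ε hε hε' x => ?_⟩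
  have hR0 : 0 < R := by linarith
  have hψ := psi_pos β x
  set f : Space N → ℝ := fun y => psi β y * (cutoff R y - cutoff R x) with hf
  have hfx : f x = 0 := by simp [hf]
  have hfc : Continuous f :=
    (continuous_psi β).mul ((contDiff_cutoff R).continuous.sub continuous_const)
  have hfb : ∀ y, |f y| ≤ 1 := by
    intro y
    rw [hf, abs_mul, abs_of_pos (psi_pos β y)]
    exact mul_le_one₀ (psi_le_one hβ _) (abs_nonneg _) (abs_cutoff_sub_le _ _ _)
  have i1 := integrable_sub_mul_kern_of_bounded hν hε (continuous_psi β) (abs_psi_le_one hβ) x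
  have i2 := integrable_sub_mul_kern_of_bounded hν hε hfc hfb x
  have split : -nonlocal ν ε (testFun R β) x = cutoff R x * -nonlocal ν ε (psi β) x +
      ∫ z, (f (x + z) - f x) * kern ν ε z := by
    rw [neg_nonlocal, neg_nonlocal, ← integral_const_mul, ← integral_add (i1.const_mul _) i2]
    congr 1; ext z
    rw [hfx]; simp only [testFun, hf]; ring
  have near : ∫ z in Metric.ball 0 (1 / 2), (f (x + z) - f x) * kern ν ε z ≤
      M * (1 / 2) ^ (N + 2 - ν) * c * psi β x / R := by
    refine (setIntegral_ball_kern_le hN hν' one_half_pos (A := M * psi β x / R)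
      (by positivity) i2.integrableOn fun z hz => ?_).trans (le_of_eq ?_)
    · rw [hfx, mul_zero, sub_zero]
      exact hM R hR x z hz.le
    · ring
  have far : ∫ z in (Metric.ball 0 (1 / 2))ᶜ, (f (x + z) - f x) * kern ν ε z ≤
      cutoffError ν β R x := by
    have i3 := integrable_cutoffError hν hβ R x
    refine (setIntegral_mono_on i2.integrableOn i3.integrableOn
      Metric.isOpen_ball.measurableSet.compl fun z hz => ?_).trans
      (setIntegral_le_integral i3 (ae_of_all _ fun z => mul_nonneg
        (mul_nonneg (psi_pos _ _).le (abs_nonneg _)) (kern_nonneg _ _ _)))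
    have hz' : 1 / 2 ≤ ‖z‖ := by simpa using hz
    rw [hfx, sub_zero, kern_of_le (hε'.trans hz'), kern_of_le hz']
    have := (psi_pos β (x + z)).le
    simp only [hf]
    gcongr
    exact le_abs_self _
  rw [split, ← integral_add_compl Metric.isOpen_ball.measurableSet i2
    (s := Metric.ball (0 : Space N) (1 / 2))]
  have h1 := mul_le_mul_of_nonneg_left (hK ε hε x) (cutoff_nonneg R x)
  have h2 : cutoff R x * (K * bracket x ^ (-α) * psi β x) =
    K * bracket x ^ (-α) * testFun R β x := by rw [testFun]; ring
  linarith

/-- The error term in the differential inequality for the test function. -/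
def testError (ν β C R : ℝ) (x : Space N) : ℝ := C * psi β x / R + C * cutoffError ν β R x

/-- The truncated mixed operator applied to the test function is bounded by a multiple of
`⟨x⟩^(-α)` times the test function, up to an error that vanishes as `R → ∞`. -/
lemma exists_mixed_testFun_le (hN : 1 ≤ N) {ν α β K c : ℝ} (hν : N < ν) (hν' : ν < N + 2)
    (hβ : 0 ≤ β) (hα : α ≤ 2) (hc : 0 ≤ c) (hK0 : 0 ≤ K)
    (hK : ∀ ε, 0 < ε → ∀ x : Space N,
      -nonlocal ν ε (psi β) x ≤ K * bracket x ^ (-α) * psi β x) :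
    ∃ C, 0 ≤ C ∧ ∀ R, 1 ≤ R → ∀ h, 0 < h → h ≤ 1 / 2 → ∀ x : Space N,
      discreteLaplacian h (testFun R β) x - c * nonlocal ν h (testFun R β) x ≤
        C * bracket x ^ (-α) * testFun R β x + testError ν β C R x := by
  obtain ⟨C₁, h₁, H₁⟩ := exists_discreteLaplacian_testFun_le (N := N) hβ hα
  obtain ⟨C₂, h₂, H₂⟩ := exists_neg_nonlocal_testFun_le hN hν hν' hβ hK
  refine ⟨C₁ + c * K + c * C₂ + c, by positivity, fun R hR h h0 h1 x => ?_⟩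
  have hR0 : 0 < R := by linarith
  have a1 := H₁ R hR h h0 h1 x
  have a2 := mul_le_mul_of_nonneg_left (H₂ R hR h h0 h1 x) hc
  have hψ : 0 ≤ psi β x / R := div_nonneg (psi_pos β x).le hR0.le
  have ht : 0 ≤ bracket x ^ (-α) * testFun R β x :=
    mul_nonneg (Real.rpow_nonneg (bracket_pos x).le _) (testFun_nonneg R β x)
  have he := cutoffError_nonneg ν β R x
  rw [testError]
  simp only [mul_assoc, mul_div_assoc] at *
  set a := bracket x ^ (-α) * testFun R β x
  set b := psi β x / R
  have := mul_nonneg h₁ he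
  have := mul_nonneg (mul_nonneg hc hK0) he
  have := mul_nonneg (mul_nonneg hc h₂) he
  have := mul_nonneg (mul_nonneg hc hK0) hψ
  have := mul_nonneg (mul_nonneg hc h₂) ht
  have := mul_nonneg hc ht
  have := mul_nonneg hc hψ
  nlinarith

lemma testError_nonneg {C R : ℝ} (hC : 0 ≤ C) (hR : 0 ≤ R) (ν β : ℝ) (x : Space N) :
    0 ≤ testError ν β C R x := by
  have := cutoffError_nonneg ν β R x
  have := psi_pos β x
  unfold testError; positivity

lemma measurable_testError (ν β C R : ℝ) : Measurable (testError ν β C R : Space N → ℝ) := by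
  have h1 := (continuous_psi (N := N) β).measurable
  have h2 := measurable_cutoffError (N := N) ν β R
  unfold testError; fun_prop

lemma exists_testError_le {ν β C : ℝ} (hν : N < ν) (hβ : 0 ≤ β) (hβν : β ≤ ν) (hC : 0 ≤ C) :
    ∃ B, 0 ≤ B ∧ ∀ R, 1 ≤ R → ∀ x : Space N, testError ν β C R x ≤ B * psi β x := by
  obtain ⟨D, hD0, hD⟩ := exists_cutoffError_le hν hβ hβν
  refine ⟨C + C * D, by positivity, fun R hR x => ?_⟩
  have h1 : C * psi β x / R ≤ C * psi β x :=
    div_le_self (mul_nonneg hC (psi_pos β x).le) hR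
  have h2 := mul_le_mul_of_nonneg_left (hD R x) hC
  rw [testError]; linarith

lemma tendsto_testError {ν β : ℝ} (hν : N < ν) (hβ : 0 ≤ β) (C : ℝ) (x : Space N) :
    Tendsto (fun n : ℕ => testError ν β C ((n : ℝ) + 1) x) atTop (𝓝 0) := by
  have h1 : Tendsto (fun n : ℕ => C * psi β x / ((n : ℝ) + 1)) atTop (𝓝 0) :=
    tendsto_const_nhds.div_atTop (tendsto_atTop_add_const_right _ _ tendsto_natCast_atTop_atTop)
  have h2 := (tendsto_cutoffError hν hβ x).const_mul C
  simpa [testError] using h1.add h2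

end TestInequality

/-! ### Symmetry and convexity of the truncated operators -/

section Pairing

variable {N : ℕ}

/-- Integrability against the weight `(1 + |y|)^(-ν)`. -/
def TailIntegrable (ν : ℝ) (g : Space N → ℝ) : Prop :=
  Integrable fun y => g y * (1 + ‖y‖) ^ (-ν)

lemma MemLs.tailIntegrable {s : ℝ} (hs : 0 ≤ s) {g : Space N → ℝ} (hg : MemLs s g) :
    TailIntegrable (N + 2 * s) g := by
  obtain ⟨hm, hfin⟩ := hg
  have hν : 0 ≤ (N : ℝ) + 2 * s := by positivity
  have hmw : ∀ a : ℝ, Measurable fun y : Space N => (1 + ‖y‖) ^ a := fun a => by fun_prop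
  have hw : Measurable fun y : Space N => 1 + ‖y‖ ^ ((N : ℝ) + 2 * s) := by fun_prop
  have h1 : Integrable fun y => |g y| / (1 + ‖y‖ ^ ((N : ℝ) + 2 * s)) := by
    refine ⟨(hm.norm.aemeasurable.div hw.aemeasurable).aestronglyMeasurable, ?_⟩
    rw [hasFiniteIntegral_iff_ofReal (ae_of_all _ fun y => by positivity)]
    exact hfin
  refine (h1.const_mul 2).mono' (hm.mul (hmw _).aestronglyMeasurable) (ae_of_all _ fun y => ?_)
  rw [norm_mul, Real.norm_eq_abs, Real.norm_of_nonneg (by positivity), Real.rpow_neg (by positivity),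
    show 2 * (|g y| / (1 + ‖y‖ ^ ((N : ℝ) + 2 * s))) =
      |g y| * ((1 + ‖y‖ ^ ((N : ℝ) + 2 * s)) / 2)⁻¹ by field_simp]
  refine mul_le_mul_of_nonneg_left (inv_anti₀ (by positivity) ?_) (abs_nonneg _)
  rw [div_le_iff₀ two_pos]
  have a1 : (1 : ℝ) ≤ (1 + ‖y‖) ^ ((N : ℝ) + 2 * s) :=
    Real.one_le_rpow (by linarith [norm_nonneg y]) hν
  have a2 : ‖y‖ ^ ((N : ℝ) + 2 * s) ≤ (1 + ‖y‖) ^ ((N : ℝ) + 2 * s) :=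
    Real.rpow_le_rpow (norm_nonneg y) (by linarith) hν
  linarith

lemma TailIntegrable.mono {ν : ℝ} {f g : Space N → ℝ} (hg : TailIntegrable ν g)
    (hf : AEStronglyMeasurable f) (h : ∀ y, |f y| ≤ |g y|) : TailIntegrable ν f := by
  have hmw : Measurable fun y : Space N => (1 + ‖y‖) ^ (-ν) := by fun_prop
  refine Integrable.mono hg (hf.mul hmw.aestronglyMeasurable) (ae_of_all _ fun y => ?_)
  rw [norm_mul, norm_mul]
  exact mul_le_mul_of_nonneg_right (h y) (norm_nonneg _)

lemma tailIntegrable_of_hasCompactSupport (ν : ℝ) {φ : Space N → ℝ} (hφ : Continuous φ)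
    (hc : HasCompactSupport φ) : TailIntegrable ν φ := by
  have : Continuous fun y : Space N => (1 + ‖y‖) ^ (-ν) :=
    (by fun_prop : Continuous fun y : Space N => 1 + ‖y‖).rpow_const
      fun y => Or.inl (by positivity)
  exact (hφ.mul this).integrable_of_hasCompactSupport hc.mul_right

lemma integrable_mul_kern_sub {ν ε : ℝ} (hν : 0 ≤ ν) (hε : 0 < ε) {g : Space N → ℝ}
    (hg : Continuous g) (hgt : TailIntegrable ν g) (x : Space N) :
    Integrable fun y => g y * kern ν ε (y - x) := by
  refine (hgt.norm.const_mul (((1 + ‖x‖) / ε + 1) ^ ν)).mono'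
    (hg.aestronglyMeasurable.mul
      ((measurable_kern ν ε).comp (measurable_id.sub_const x)).aestronglyMeasurable)
    (ae_of_all _ fun y => ?_)
  rw [norm_mul, norm_mul, Real.norm_of_nonneg (kern_nonneg _ _ _),
    Real.norm_of_nonneg (by positivity : 0 ≤ (1 + ‖y‖) ^ (-ν))]
  calc _ ≤ ‖g y‖ * (((1 + ‖x‖) / ε + 1) ^ ν * (1 + ‖y‖) ^ (-ν)) := by
        gcongr; exact kern_sub_le hν hε x y
    _ = _ := by ring

lemma integrable_sub_mul_kern {ν ε : ℝ} (hν : N < ν) (hε : 0 < ε) {g : Space N → ℝ}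
    (hg : Continuous g) (hgt : TailIntegrable ν g) (x : Space N) :
    Integrable fun z => (g x - g (x + z)) * kern ν ε z := by
  have h1 := (integrable_mul_kern_sub ((Nat.cast_nonneg N).trans hν.le) hε hg hgt x).comp_add_left x
  simp only [add_sub_cancel_left] at h1
  simp only [sub_mul]
  exact ((integrable_kern hν hε).const_mul (g x)).sub h1

/-- The truncated kernel is integrable, so the operator is a multiple of the identity minus a
convolution with an even kernel. This reduces its symmetry to Fubini. -/
lemma nonlocal_eq {ν ε : ℝ} (hν : N < ν) (hε : 0 < ε) {g : Space N → ℝ}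
    (hg : Continuous g) (hgt : TailIntegrable ν g) (x : Space N) :
    nonlocal ν ε g x = g x * (∫ z : Space N, kern ν ε z) - ∫ y, g y * kern ν ε (y - x) := by
  have h1 := (integrable_mul_kern_sub ((Nat.cast_nonneg N).trans hν.le) hε hg hgt x).comp_add_left x
  have h2 := integral_add_left_eq_self (fun y => g y * kern ν ε (y - x)) x (μ := volume)
  simp only [add_sub_cancel_left] at h1 h2
  rw [nonlocal, ← h2, ← integral_const_mul,
    ← integral_sub ((integrable_kern hν hε).const_mul (g x)) h1]
  simp only [sub_mul]

lemma integrable_prod_mul_kern {ν ε : ℝ} (hν : 0 ≤ ν) (hε : 0 < ε)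
    {φ g : Space N → ℝ} (hφ : Continuous φ) (hc : HasCompactSupport φ)
    (hg : Continuous g) (hgt : TailIntegrable ν g) :
    Integrable (fun p : Space N × Space N => φ p.1 * (g p.2 * kern ν ε (p.2 - p.1)))
      (volume.prod volume) := by
  obtain ⟨ρ, hρ0, hρ⟩ := hc.isCompact.isBounded.exists_pos_norm_le
  have hm := measurable_kern (N := N) ν ε
  refine (((hφ.integrable_of_hasCompactSupport hc).norm.mul_prod hgt.norm).const_mul
    (((1 + ρ) / ε + 1) ^ ν)).mono' ?_ (ae_of_all _ fun p => ?_)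
  · have h1 := hφ.measurable
    have h2 := hg.measurable
    exact Measurable.aestronglyMeasurable (by fun_prop)
  · obtain ⟨x, y⟩ := p
    by_cases hx : φ x = 0
    · simp only [hx, zero_mul, norm_zero, mul_zero, le_refl]
    · have hxρ : ‖x‖ ≤ ρ := hρ x (subset_tsupport _ hx)
      simp only [norm_mul, Real.norm_of_nonneg (kern_nonneg ν ε _),
        Real.norm_of_nonneg (by positivity : 0 ≤ (1 + ‖y‖) ^ (-ν))]
      calc _ ≤ ‖φ x‖ * (‖g y‖ * (((1 + ‖x‖) / ε + 1) ^ ν * (1 + ‖y‖) ^ (-ν))) := by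
            gcongr; exact kern_sub_le hν hε x y
        _ ≤ ‖φ x‖ * (‖g y‖ * (((1 + ρ) / ε + 1) ^ ν * (1 + ‖y‖) ^ (-ν))) := by
            gcongr
        _ = _ := by ring

lemma integrable_mul_nonlocal {ν ε : ℝ} (hν : N < ν) (hε : 0 < ε)
    {φ g : Space N → ℝ} (hφ : Continuous φ) (hc : HasCompactSupport φ)
    (hg : Continuous g) (hgt : TailIntegrable ν g) :
    Integrable (fun x => φ x * nonlocal ν ε g x) := by
  have hν0 := (Nat.cast_nonneg N).trans hν.le
  have i1 := (integrable_prod_mul_kern hν0 hε hφ hc hg hgt).integral_prod_left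
  have i2 : Integrable fun x => φ x * g x :=
    (hφ.mul hg).integrable_of_hasCompactSupport hc.mul_right
  simp only [integral_const_mul] at i1
  refine ((i2.mul_const (∫ z : Space N, kern ν ε z)).sub i1).congr (ae_of_all _ fun x => ?_)
  simp only [Pi.sub_apply, nonlocal_eq hν hε hg hgt]; ring

/-- The truncated nonlocal operator is symmetric. -/
lemma integral_mul_nonlocal_comm {ν ε : ℝ} (hν : N < ν) (hε : 0 < ε)
    {φ g : Space N → ℝ} (hφ : Continuous φ) (hc : HasCompactSupport φ)
    (hg : Continuous g) (hgt : TailIntegrable ν g) :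
    Integrable (fun x => g x * nonlocal ν ε φ x) ∧
      ∫ x, φ x * nonlocal ν ε g x = ∫ x, g x * nonlocal ν ε φ x := by
  have hν0 := (Nat.cast_nonneg N).trans hν.le
  have i0 := integrable_prod_mul_kern hν0 hε hφ hc hg hgt
  have hφt := tailIntegrable_of_hasCompactSupport ν hφ hc
  have i1 : Integrable fun x => φ x * ∫ y, g y * kern ν ε (y - x) := by
    simpa only [integral_const_mul] using i0.integral_prod_left
  have e : ∀ y, ∫ x, φ x * (g y * kern ν ε (y - x)) = g y * ∫ x, φ x * kern ν ε (x - y) := by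
    intro y
    rw [← integral_const_mul]
    congr 1; ext x
    rw [← kern_neg, neg_sub]; ring
  have i2 : Integrable fun y => g y * ∫ x, φ x * kern ν ε (x - y) := by
    simpa only [e] using i0.integral_prod_right
  have i3 : Integrable fun x => φ x * g x :=
    (hφ.mul hg).integrable_of_hasCompactSupport hc.mul_right
  set κ := ∫ z : Space N, kern ν ε z
  have e1 : (fun x => φ x * nonlocal ν ε g x) = fun x => φ x * g x * κ -
      φ x * ∫ y, g y * kern ν ε (y - x) := by
    ext x; rw [nonlocal_eq hν hε hg hgt]; ring
  have e2 : (fun x => g x * nonlocal ν ε φ x) = fun x => φ x * g x * κ -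
      g x * ∫ y, φ y * kern ν ε (y - x) := by
    ext x; rw [nonlocal_eq hν hε hφ hφt]; ring
  rw [e1, e2]
  refine ⟨(i3.mul_const κ).sub i2, ?_⟩
  rw [integral_sub (i3.mul_const κ) i1, integral_sub (i3.mul_const κ) i2]
  congr 1
  have := integral_integral_swap (f := fun x y => φ x * (g y * kern ν ε (y - x))) i0
  simpa only [integral_const_mul, e] using this

lemma continuous_discreteLaplacian (h : ℝ) {g : Space N → ℝ} (hg : Continuous g) :
    Continuous (discreteLaplacian h g) := by
  unfold discreteLaplacian; fun_prop

lemma hasCompactSupport_discreteLaplacian (h : ℝ) {φ : Space N → ℝ} (hc : HasCompactSupport φ) :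
    HasCompactSupport (discreteLaplacian h φ) := by
  obtain ⟨ρ, hρ0, hρ⟩ := hc.isCompact.isBounded.exists_pos_norm_le
  have hz : ∀ y, ρ < ‖y‖ → φ y = 0 := fun y hy => by
    by_contra h0; exact absurd (hρ y (subset_tsupport _ h0)) (not_le.2 hy)
  refine HasCompactSupport.of_support_subset_isCompact
    (isCompact_closedBall 0 (ρ + |h|)) fun x hx => ?_
  by_contra hm
  have hx' : ρ + |h| < ‖x‖ := by simpa using hm
  refine hx (Finset.sum_eq_zero fun i _ => ?_)
  have hn : ‖h • EuclideanSpace.basisFun (Fin N) ℝ i‖ = |h| := by simp [norm_smul]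
  have a1 := norm_sub_le (x + h • EuclideanSpace.basisFun (Fin N) ℝ i)
    (h • EuclideanSpace.basisFun (Fin N) ℝ i)
  have a2 := norm_add_le (x - h • EuclideanSpace.basisFun (Fin N) ℝ i)
    (h • EuclideanSpace.basisFun (Fin N) ℝ i)
  rw [add_sub_cancel_right, hn] at a1
  rw [sub_add_cancel, hn] at a2
  rw [hz _ (by linarith), hz _ (by linarith), hz x (by linarith [abs_nonneg h])]
  simp

/-- The discrete Laplacian is symmetric. -/
lemma integral_mul_discreteLaplacian_comm (h : ℝ) {φ g : Space N → ℝ} (hφ : Continuous φ)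
    (hc : HasCompactSupport φ) (hg : Continuous g) :
    ∫ x, φ x * discreteLaplacian h g x = ∫ x, g x * discreteLaplacian h φ x := by
  have i1 : ∀ z : Space N, Integrable fun x => φ x * g (x + z) := fun z =>
    (hφ.mul (by fun_prop)).integrable_of_hasCompactSupport hc.mul_right
  have i2 : ∀ z : Space N, Integrable fun x => g x * φ (x + z) := fun z => by
    have := (i1 (-z)).comp_add_right z
    simpa only [add_neg_cancel_right, mul_comm] using this
  have sh : ∀ z : Space N, ∫ x, φ x * g (x + z) = ∫ x, g x * φ (x - z) := fun z => by
    rw [← integral_add_right_eq_self (fun x => g x * φ (x - z)) z]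
    simp only [add_sub_cancel_right, mul_comm]
  have key : ∀ z : Space N, Integrable (fun x => φ x * ((g (x + z) + g (x - z) - 2 * g x) / h ^ 2)) ∧
      Integrable (fun x => g x * ((φ (x + z) + φ (x - z) - 2 * φ x) / h ^ 2)) ∧
      ∫ x, φ x * ((g (x + z) + g (x - z) - 2 * g x) / h ^ 2) =
        ∫ x, g x * ((φ (x + z) + φ (x - z) - 2 * φ x) / h ^ 2) := by
    intro z
    have a1 := i1 z
    have a2 := i1 (-z)
    have a3 := (i1 0).const_mul 2
    have b1 := i2 z
    have b2 := i2 (-z)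
    have b3 := (i2 0).const_mul 2
    simp only [← sub_eq_add_neg, add_zero] at a2 a3 b2 b3
    have e1 : (fun x => φ x * ((g (x + z) + g (x - z) - 2 * g x) / h ^ 2)) =
        fun x => (φ x * g (x + z) + φ x * g (x - z) - 2 * (φ x * g x)) / h ^ 2 := by ext x; ring
    have e2 : (fun x => g x * ((φ (x + z) + φ (x - z) - 2 * φ x) / h ^ 2)) =
        fun x => (g x * φ (x + z) + g x * φ (x - z) - 2 * (g x * φ x)) / h ^ 2 := by ext x; ring
    rw [e1, e2]
    refine ⟨((a1.add a2).sub a3).div_const _, ((b1.add b2).sub b3).div_const _, ?_⟩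
    have c1 := sh z
    have c2 := sh (-z)
    simp only [← sub_eq_add_neg, sub_neg_eq_add] at c2
    have f1 := (integral_sub (a1.add a2) a3).trans (congrArg (· - _) (integral_add a1 a2))
    have f2 := (integral_sub (b1.add b2) b3).trans (congrArg (· - _) (integral_add b1 b2))
    simp only [Pi.add_apply] at f1 f2
    have f3 : ∫ x, 2 * (g x * φ x) = ∫ x, 2 * (φ x * g x) := by simp only [mul_comm]
    rw [integral_div, integral_div, f1, f2, c1, c2, f3, add_comm (∫ x, g x * φ (x - z))]
  simp only [discreteLaplacian, Finset.mul_sum]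
  rw [integral_finsetSum _ fun i _ => (key _).1, integral_finsetSum _ fun i _ => (key _).2.1]
  exact Finset.sum_congr rfl fun i _ => (key _).2.2

variable {G G' : ℝ → ℝ}

/-- The tangent-line inequality at `f x` is integrated against a nonnegative kernel. Truncation is
what lets `G ∘ f` be merely continuous and tail-integrable. -/
lemma nonlocal_comp_le (hG : ∀ a b, G a + G' a * (b - a) ≤ G b) {ν ε : ℝ} (hν : N < ν)
    (hε : 0 < ε) (hGc : Continuous G) {f : Space N → ℝ} (hf : Continuous f)
    (hft : TailIntegrable ν f) (hGt : TailIntegrable ν (G ∘ f)) (x : Space N) :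
    nonlocal ν ε (G ∘ f) x ≤ G' (f x) * nonlocal ν ε f x := by
  rw [nonlocal, nonlocal, ← integral_const_mul]
  refine integral_mono (integrable_sub_mul_kern hν hε (hGc.comp hf) hGt x)
    ((integrable_sub_mul_kern hν hε hf hft x).const_mul _) fun z => ?_
  have := hG (f x) (f (x + z))
  have hk := kern_nonneg ν ε z
  simp only [Function.comp_apply]
  nlinarith

lemma le_discreteLaplacian_comp (hG : ∀ a b, G a + G' a * (b - a) ≤ G b) (h : ℝ)
    (f : Space N → ℝ) (x : Space N) :
    G' (f x) * discreteLaplacian h f x ≤ discreteLaplacian h (G ∘ f) x := by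
  rw [discreteLaplacian, discreteLaplacian, Finset.mul_sum]
  refine Finset.sum_le_sum fun i _ => ?_
  rw [← mul_div_assoc]
  set z := h • EuclideanSpace.basisFun (Fin N) ℝ i
  have h1 := hG (f x) (f (x + z))
  have h2 := hG (f x) (f (x - z))
  gcongr
  simp only [Function.comp_apply]
  linarith

end Pairing

/-! ### The integrated inequality at a fixed time -/

section FixedTime

variable {N : ℕ}

lemma setIntegral_eq_nonlocal (s ε : ℝ) (f : Space N → ℝ) (x : Space N) :
    ∫ y in {y : Space N | ε ≤ ‖x - y‖}, (f x - f y) / ‖x - y‖ ^ ((N : ℝ) + 2 * s) =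
      nonlocal (N + 2 * s) ε f x := by
  have hm : MeasurableSet {y : Space N | ε ≤ ‖x - y‖} :=
    measurableSet_le measurable_const (by fun_prop)
  rw [← integral_indicator hm, nonlocal, ← integral_add_left_eq_self _ x]
  congr 1; ext z
  simp only [kern, indicator, mem_ofPred_eq, sub_add_cancel_left, norm_neg]
  split_ifs
  · rw [Real.rpow_neg (norm_nonneg z), div_eq_mul_inv]
  · simp

lemma hasFracLaplacianAt_iff {s L : ℝ} {f : Space N → ℝ} {x : Space N} :
    HasFracLaplacianAt s f x L ↔
      Tendsto (fun ε => fracConst N s * nonlocal (N + 2 * s) ε f x) (𝓝[>] 0) (𝓝 L) := by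
  simp only [HasFracLaplacianAt, setIntegral_eq_nonlocal]

lemma fracConst_nonneg {s : ℝ} (hs : s ∈ Ioo (0 : ℝ) 1) : 0 ≤ fracConst N s := by
  have h0 := hs.1
  have h1 : 0 < Real.Gamma (1 - s) := Real.Gamma_pos_of_pos (by linarith [hs.2])
  have h2 : 0 < Real.Gamma (((N : ℝ) + 2 * s) / 2) := Real.Gamma_pos_of_pos (by positivity)
  unfold fracConst
  have := Real.pi_pos
  positivity

/-- By l'Hôpital the quotient has the limit of `(Df(x+he)e - Df(x-he)e)/(2h)`, a difference quotient
at 0 of a function with derivative `2 D²f(x)(e,e)`. -/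
lemma tendsto_second_difference {f : Space N → ℝ} (hf : ContDiff ℝ 2 f) (x e : Space N) :
    Tendsto (fun h : ℝ => (f (x + h • e) + f (x - h • e) - 2 * f x) / h ^ 2) (𝓝[>] 0)
      (𝓝 (iteratedFDeriv ℝ 2 f x ![e, e])) := by
  have hfd : Differentiable ℝ f := hf.differentiable two_ne_zero
  have hfd2 : Differentiable ℝ (fderiv ℝ f) :=
    (hf.fderiv_right (m := 1) (by norm_num)).differentiable one_ne_zero
  have l1 : ∀ τ : ℝ, HasDerivAt (fun τ : ℝ => x + τ • e) e τ := fun τ => by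
    simpa using ((hasDerivAt_id τ).smul_const e).const_add x
  have l2 : ∀ τ : ℝ, HasDerivAt (fun τ : ℝ => x - τ • e) (-e) τ := fun τ => by
    simpa using ((hasDerivAt_id τ).smul_const e).const_sub x
  have hd : ∀ τ : ℝ, HasDerivAt (fun τ : ℝ => f (x + τ • e) + f (x - τ • e) - 2 * f x)
      (fderiv ℝ f (x + τ • e) e - fderiv ℝ f (x - τ • e) e) τ := fun τ => by
    have := (((hfd _).hasFDerivAt.comp_hasDerivAt τ (l1 τ)).add
      ((hfd _).hasFDerivAt.comp_hasDerivAt τ (l2 τ))).sub_const (2 * f x)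
    exact this.congr_deriv (by rw [map_neg, ← sub_eq_add_neg])
  set d := iteratedFDeriv ℝ 2 f x ![e, e] with hddef
  have hd2 : HasDerivAt (fun τ : ℝ => fderiv ℝ f (x + τ • e) e - fderiv ℝ f (x - τ • e) e)
      (2 * d) 0 := by
    have hg : ∀ y, HasFDerivAt (fun y => fderiv ℝ f y e)
        ((ContinuousLinearMap.apply ℝ ℝ e).comp (fderiv ℝ (fderiv ℝ f) y)) y := fun y =>
      (ContinuousLinearMap.apply ℝ ℝ e).hasFDerivAt.comp y (hfd2 y).hasFDerivAt
    have h1 := (hg (x + (0 : ℝ) • e)).comp_hasDerivAt 0 (l1 0)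
    have h2 := (hg (x - (0 : ℝ) • e)).comp_hasDerivAt 0 (l2 0)
    refine (h1.sub h2).congr_deriv ?_
    rw [hddef, iteratedFDeriv_two_apply]
    simp only [zero_smul, add_zero, sub_zero, map_neg, sub_neg_eq_add, two_mul]
    rfl
  refine HasDerivAt.lhopital_zero_nhdsGT (f' := fun τ => fderiv ℝ f (x + τ • e) e -
    fderiv ℝ f (x - τ • e) e) (g' := fun τ => 2 * τ) (Eventually.of_forall hd)
    (Eventually.of_forall fun τ => by simpa using hasDerivAt_pow 2 τ)
    (eventually_nhdsWithin_of_forall fun τ (hτ : 0 < τ) => by positivity) ?_ ?_ ?_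
  · have := (hd 0).continuousAt.tendsto
    simp only [zero_smul, add_zero, sub_zero] at this
    rw [show f x + f x - 2 * f x = 0 by ring] at this
    exact this.mono_left nhdsWithin_le_nhds
  · have : Tendsto (fun x : ℝ => x ^ 2) (𝓝 0) (𝓝 (0 ^ 2)) := (continuous_pow 2).tendsto 0
    simpa using this.mono_left nhdsWithin_le_nhds
  · have := hd2.tendsto_slope_zero_right.div_const 2
    rw [mul_div_cancel_left₀ d two_ne_zero] at this
    refine this.congr fun τ => ?_
    simp only [zero_add, zero_smul, add_zero, sub_zero, sub_self, smul_eq_mul]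
    field_simp

lemma tendsto_discreteLaplacian {f : Space N → ℝ} (hf : ContDiff ℝ 2 f) (x : Space N) :
    Tendsto (fun h : ℝ => discreteLaplacian h f x) (𝓝[>] 0)
      (𝓝 ((Laplacian.laplacian f : Space N → ℝ) x)) := by
  rw [InnerProductSpace.laplacian_eq_iteratedFDeriv_orthonormalBasis f
    (EuclideanSpace.basisFun (Fin N) ℝ)]
  exact tendsto_finsetSum _ fun i _ => tendsto_second_difference hf x _

lemma exists_second_difference_bound {f : Space N → ℝ} (hf : ContDiff ℝ 2 f) (ρ : ℝ) :
    ∃ K, 0 ≤ K ∧ ∀ x z : Space N, ‖x‖ ≤ ρ → ‖z‖ ≤ 1 →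
      |f (x + z) + f (x - z) - 2 * f x| ≤ K * ‖z‖ ^ 2 := by
  obtain ⟨K, hK⟩ := (hf.fderiv_right (m := 1) (by norm_num)).contDiffOn.exists_lipschitzOnWith
    one_ne_zero (convex_closedBall (0 : Space N) (ρ + 1)) (isCompact_closedBall _ _)
  refine ⟨2 * K, by positivity, fun x z hx hz => ?_⟩
  refine abs_second_difference_le (hf.differentiable two_ne_zero)
    (convex_closedBall (0 : Space N) (ρ + 1)) hK ?_ ?_
  · rw [mem_closedBall_zero_iff]; exact (norm_add_le _ _).trans (add_le_add hx hz)
  · rw [mem_closedBall_zero_iff]; exact (norm_sub_le _ _).trans (add_le_add hx hz)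

lemma exists_discreteLaplacian_bound {f : Space N → ℝ} (hf : ContDiff ℝ 2 f) (ρ : ℝ) :
    ∃ B, ∀ x : Space N, ‖x‖ ≤ ρ → ∀ h, 0 < h → h ≤ 1 → |discreteLaplacian h f x| ≤ B := by
  obtain ⟨K, hK0, hK⟩ := exists_second_difference_bound hf ρ
  refine ⟨∑ _i : Fin N, K, fun x hx h h0 h1 => ?_⟩
  refine (Finset.abs_sum_le_sum_abs _ _).trans (Finset.sum_le_sum fun i _ => ?_)
  have hn : ‖h • EuclideanSpace.basisFun (Fin N) ℝ i‖ = h := by simp [norm_smul, abs_of_pos h0]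
  have := hK x (h • EuclideanSpace.basisFun (Fin N) ℝ i) hx (by rw [hn]; exact h1)
  rw [hn] at this
  rw [abs_div, abs_of_pos (by positivity : 0 < h ^ 2), div_le_iff₀ (by positivity)]
  exact this

/-- Uniformity in `h` is needed for dominated convergence as `h → 0`. Inside the unit ball the
second-difference bound is applied to `f` and to `-f`; outside it the integral is the operator
truncated at 1, which does not depend on `h`. -/
lemma exists_nonlocal_bound (hN : 1 ≤ N) {ν : ℝ} (hν : N < ν) (hν' : ν < N + 2)
    {f : Space N → ℝ} (hf : ContDiff ℝ 2 f) (hft : TailIntegrable ν f) (ρ : ℝ) :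
    ∃ B, ∀ x : Space N, ‖x‖ ≤ ρ → ∀ h, 0 < h → h ≤ 1 → |nonlocal ν h f x| ≤ B := by
  have hν0 : 0 ≤ ν := (Nat.cast_nonneg N).trans hν.le
  obtain ⟨K, hK0, hK⟩ := exists_second_difference_bound hf ρ
  obtain ⟨F, hF⟩ := (isCompact_closedBall (0 : Space N) ρ).exists_bound_of_continuousOn
    hf.continuous.continuousOn
  set c := ∫ z in Metric.ball (0 : Space N) 1, ‖z‖ ^ (2 - ν)
  set I := ∫ y, ‖f y * (1 + ‖y‖) ^ (-ν)‖
  set κ := ∫ z : Space N, kern ν 1 z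
  have hκ : 0 ≤ κ := integral_nonneg fun z => kern_nonneg _ _ _
  have hI : 0 ≤ I := integral_nonneg fun z => norm_nonneg _
  refine ⟨K * 1 ^ (N + 2 - ν) * c + (F * κ + ((1 + ρ) / 1 + 1) ^ ν * I), fun x hx h h0 h1 => ?_⟩
  have one : |nonlocal ν 1 f x| ≤ F * κ + ((1 + ρ) / 1 + 1) ^ ν * I := by
    rw [nonlocal_eq hν one_pos hf.continuous hft]
    refine (abs_sub _ _).trans (add_le_add ?_ ?_)
    · rw [abs_mul, abs_of_nonneg hκ]
      gcongr
      exact hF x (by simpa using hx)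
    · rw [← integral_const_mul, ← Real.norm_eq_abs]
      refine norm_integral_le_of_norm_le (Integrable.const_mul (Integrable.norm hft) _)
        (ae_of_all _ fun y => ?_)
      rw [norm_mul, norm_mul, Real.norm_of_nonneg (kern_nonneg _ _ _),
        Real.norm_of_nonneg (by positivity : 0 ≤ (1 + ‖y‖) ^ (-ν))]
      have hρ : 0 ≤ ρ := (norm_nonneg x).trans hx
      calc _ ≤ ‖f y‖ * (((1 + ‖x‖) / 1 + 1) ^ ν * (1 + ‖y‖) ^ (-ν)) := by
            gcongr; exact kern_sub_le hν0 one_pos x y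
        _ ≤ ‖f y‖ * (((1 + ρ) / 1 + 1) ^ ν * (1 + ‖y‖) ^ (-ν)) := by gcongr
        _ = _ := by ring
  have i1 := integrable_sub_mul_kern hν h0 hf.continuous hft x
  have i2 : Integrable fun z => (f (x + z) - f x) * kern ν h z := by
    refine i1.neg.congr (ae_of_all _ fun z => ?_)
    simp only [Pi.neg_apply]; ring
  have i3 : Integrable fun z => ((-f) (x + z) - (-f) x) * kern ν h z := by
    refine i1.congr (ae_of_all _ fun z => ?_)
    simp only [Pi.neg_apply]; ring
  have n1 := setIntegral_ball_kern_le hN hν' one_pos hK0 i2.integrableOn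
    fun z hz => (le_abs_self _).trans (hK x z hx hz.le)
  have n2 := setIntegral_ball_kern_le hN hν' one_pos hK0 i3.integrableOn
    fun z hz => by
      refine le_trans ?_ ((neg_le_abs _).trans (hK x z hx hz.le))
      simp only [Pi.neg_apply]; linarith
  have e2 : ∫ z in Metric.ball 0 1, ((-f) (x + z) - (-f) x) * kern ν h z =
      -∫ z in Metric.ball 0 1, (f (x + z) - f x) * kern ν h z := by
    rw [← integral_neg]; congr 1; ext z; simp only [Pi.neg_apply]; ring
  have far : ∫ z in (Metric.ball 0 1)ᶜ, (f (x + z) - f x) * kern ν h z = -nonlocal ν 1 f x := by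
    have hm : MeasurableSet (Metric.ball (0 : Space N) 1)ᶜ :=
      Metric.isOpen_ball.measurableSet.compl
    rw [neg_nonlocal, ← integral_indicator hm]
    congr 1; ext z
    by_cases hz : 1 ≤ ‖z‖
    · rw [indicator_of_mem (by simpa using hz), kern_of_le (h1.trans hz), kern_of_le hz]
    · rw [indicator_of_notMem (by simpa using hz), kern_of_lt (not_le.1 hz), mul_zero]
  have tot : -nonlocal ν h f x = (∫ z in Metric.ball 0 1, (f (x + z) - f x) * kern ν h z) +
      -nonlocal ν 1 f x := by
    rw [neg_nonlocal, ← far, integral_add_compl Metric.isOpen_ball.measurableSet i2]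
  rw [e2] at n2
  rw [← abs_neg, tot]
  refine (abs_add_le _ _).trans (add_le_add (abs_le.2 ⟨by linarith, n1⟩) (by rwa [abs_neg]))

variable {G G' : ℝ → ℝ}

/-- Testing a solution of `Δf - c(-Δ)^s f = D` with `φ G'(f)`, where `G` is convex. -/
lemma integral_test_le (hN : 1 ≤ N) {ν c : ℝ} (hν : N < ν) (hν' : ν < N + 2) (hc : 0 ≤ c)
    (hG : ∀ a b, G a + G' a * (b - a) ≤ G b) (hG0 : ∀ a, 0 ≤ G a) (hGc : Continuous G)
    (hGc' : Continuous G') {f D φ Φ : Space N → ℝ} (hf : ContDiff ℝ 2 f)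
    (hft : TailIntegrable ν f) (hGt : TailIntegrable ν (G ∘ f))
    (hD : ∀ x, Tendsto (fun h => discreteLaplacian h f x - c * nonlocal ν h f x)
      (𝓝[>] 0) (𝓝 (D x)))
    (hφ : Continuous φ) (hφc : HasCompactSupport φ) (hφ0 : ∀ x, 0 ≤ φ x)
    (hΦ : ∀ h, 0 < h → h ≤ 1 / 2 → ∀ x,
      discreteLaplacian h φ x - c * nonlocal ν h φ x ≤ Φ x)
    (hΦi : Integrable fun x => G (f x) * Φ x) :
    ∫ x, φ x * G' (f x) * D x ≤ ∫ x, G (f x) * Φ x := by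
  have hfc := hf.continuous
  have hGf : Continuous (G ∘ f) := hGc.comp hfc
  have hχ : Continuous fun x => φ x * G' (f x) := hφ.mul (hGc'.comp hfc)
  have hχc : HasCompactSupport fun x => φ x * G' (f x) := hφc.mul_right
  -- At fixed `h`: convexity replaces `G'(f)` times the operator on `f` by the operator on `G ∘ f`,
  -- symmetry moves it to `φ`, and `G ≥ 0` allows the one-sided bound `Φ`. The right side is free of
  -- `h`.
  have hle : ∀ h, 0 < h → h ≤ 1 / 2 →
      ∫ x, φ x * G' (f x) * (discreteLaplacian h f x - c * nonlocal ν h f x) ≤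
        ∫ x, G (f x) * Φ x := by
    intro h h0 h1
    have i1 : Integrable fun x => φ x * G' (f x) * discreteLaplacian h f x :=
      (hχ.mul (continuous_discreteLaplacian h hfc)).integrable_of_hasCompactSupport hχc.mul_right
    have i2 := integrable_mul_nonlocal hν h0 hχ hχc hfc hft
    have i3 : Integrable fun x => φ x * discreteLaplacian h (G ∘ f) x :=
      (hφ.mul (continuous_discreteLaplacian h hGf)).integrable_of_hasCompactSupport hφc.mul_right
    have i4 := integrable_mul_nonlocal hν h0 hφ hφc hGf hGt
    have i5 : Integrable fun x => (G ∘ f) x * discreteLaplacian h φ x :=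
      (hGf.mul (continuous_discreteLaplacian h hφ)).integrable_of_hasCompactSupport
        (hasCompactSupport_discreteLaplacian h hφc).mul_left
    obtain ⟨i6, e6⟩ := integral_mul_nonlocal_comm hν h0 hφ hφc hGf hGt
    calc ∫ x, φ x * G' (f x) * (discreteLaplacian h f x - c * nonlocal ν h f x)
        ≤ ∫ x, (φ x * discreteLaplacian h (G ∘ f) x - c * (φ x * nonlocal ν h (G ∘ f) x)) := by
          refine integral_mono ((i1.sub (i2.const_mul c)).congr (ae_of_all _ fun x => ?_))
            (i3.sub (i4.const_mul c)) fun x => ?_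
          · simp only [Pi.sub_apply]; ring
          · have a1 := mul_le_mul_of_nonneg_left (le_discreteLaplacian_comp hG h f x) (hφ0 x)
            have a2 := mul_le_mul_of_nonneg_left
              (nonlocal_comp_le hG hν h0 hGc hfc hft hGt x) (mul_nonneg hc (hφ0 x))
            beta_reduce
            linarith
      _ = ∫ x, ((G ∘ f) x * discreteLaplacian h φ x - c * ((G ∘ f) x * nonlocal ν h φ x)) := by
          rw [integral_sub i3 (i4.const_mul c), integral_sub i5 (i6.const_mul c),
            integral_const_mul, integral_const_mul, e6,
            integral_mul_discreteLaplacian_comm h hφ hφc hGf]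
      _ ≤ ∫ x, G (f x) * Φ x := by
          refine integral_mono (i5.sub (i6.const_mul c)) hΦi fun x => ?_
          have := mul_le_mul_of_nonneg_left (hΦ h h0 h1 x) (hG0 (f x))
          simp only [Function.comp_apply]
          linarith
  obtain ⟨ρ, hρ0, hρ⟩ := hφc.isCompact.isBounded.exists_pos_norm_le
  obtain ⟨B₁, hB₁⟩ := exists_discreteLaplacian_bound hf ρ
  obtain ⟨B₂, hB₂⟩ := exists_nonlocal_bound hN hν hν' hf hft ρ
  -- The shift by 2 keeps every step size at most `1/2`, the range in which the bound `Φ` is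
  -- available.
  have hn : Tendsto (fun n : ℕ => 1 / ((n : ℝ) + 2)) atTop (𝓝[>] 0) := by
    refine tendsto_nhdsWithin_iff.2 ⟨?_, Eventually.of_forall fun n => ?_⟩
    · exact tendsto_const_nhds.div_atTop
        (tendsto_atTop_add_const_right _ _ tendsto_natCast_atTop_atTop)
    · exact mem_Ioi.2 (by positivity)
  have hn0 : ∀ n : ℕ, 0 < 1 / ((n : ℝ) + 2) := fun n => by positivity
  have hn1 : ∀ n : ℕ, 1 / ((n : ℝ) + 2) ≤ 1 / 2 := fun n =>
    one_div_le_one_div_of_le two_pos (by linarith [Nat.cast_nonneg (α := ℝ) n])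
  refine le_of_tendsto' (tendsto_integral_of_dominated_convergence
    (F := fun (n : ℕ) x => φ x * G' (f x) * (discreteLaplacian (1 / ((n : ℝ) + 2)) f x -
      c * nonlocal ν (1 / ((n : ℝ) + 2)) f x))
    (fun x => ‖φ x * G' (f x)‖ * (B₁ + c * B₂)) (fun n => ?_)
    ((hχ.integrable_of_hasCompactSupport hχc).norm.mul_const _)
    (fun n => ae_of_all _ fun x => ?_) (ae_of_all _ fun x => ?_)) fun n => hle _ (hn0 n) (hn1 n)
  · have i1 : Integrable fun x => φ x * G' (f x) * discreteLaplacian (1 / ((n : ℝ) + 2)) f x :=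
      (hχ.mul (continuous_discreteLaplacian _ hfc)).integrable_of_hasCompactSupport hχc.mul_right
    have i2 := integrable_mul_nonlocal hν (hn0 n) hχ hχc hfc hft
    refine (i1.sub (i2.const_mul c)).aestronglyMeasurable.congr (ae_of_all _ fun x => ?_)
    simp only [Pi.sub_apply]; ring
  · rw [norm_mul]
    by_cases hx : φ x = 0
    · simp only [hx, zero_mul, norm_zero, le_refl]
    · have hxρ : ‖x‖ ≤ ρ := hρ x (subset_tsupport _ hx)
      gcongr
      refine (norm_sub_le _ _).trans ?_
      rw [norm_mul, Real.norm_of_nonneg hc]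
      have hl : 1 / ((n : ℝ) + 2) ≤ 1 := (hn1 n).trans (by norm_num)
      gcongr
      · exact hB₁ x hxρ _ (hn0 n) hl
      · exact hB₂ x hxρ _ (hn0 n) hl
  · exact ((hD x).comp hn).const_mul _

end FixedTime

/-! ### A convex profile -/

section Profile

/-- The convex function `(√(1 + r²) - 1)^n`. -/
def profile (n : ℕ) (r : ℝ) : ℝ := (√(1 + r ^ 2) - 1) ^ n

lemma one_le_sqrt_one_add_sq (r : ℝ) : 1 ≤ √(1 + r ^ 2) :=
  Real.one_le_sqrt.2 (by nlinarith [sq_nonneg r])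

lemma profile_nonneg (n : ℕ) (r : ℝ) : 0 ≤ profile n r :=
  pow_nonneg (sub_nonneg.2 (one_le_sqrt_one_add_sq r)) n

lemma profile_zero {n : ℕ} (hn : n ≠ 0) : profile n 0 = 0 := by simp [profile, hn]

lemma eq_zero_of_profile_eq_zero {n : ℕ} {r : ℝ} (h : profile n r = 0) : r = 0 := by
  have h1 : √(1 + r ^ 2) = 1 := sub_eq_zero.1 (eq_zero_of_pow_eq_zero h)
  have h2 := Real.sq_sqrt (by positivity : 0 ≤ 1 + r ^ 2)
  rw [h1] at h2
  exact pow_eq_zero_iff two_ne_zero |>.1 (by linarith)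

lemma contDiff_profile (n : ℕ) : ContDiff ℝ 1 (profile n) := by
  unfold profile
  exact (((contDiff_const.add (contDiff_id.pow 2)).sqrt fun r => by
    have : 0 < 1 + r ^ 2 := by positivity
    exact this.ne').sub contDiff_const).pow n

lemma convexOn_profile (n : ℕ) : ConvexOn ℝ univ (profile n) := by
  have h : ConvexOn ℝ univ fun r : ℝ => √(1 + r ^ 2) - 1 := by
    refine ⟨convex_univ, fun x _ y _ a b ha hb hab => ?_⟩
    simp only [smul_eq_mul]
    have hx := Real.sq_sqrt (by positivity : 0 ≤ 1 + x ^ 2)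
    have hy := Real.sq_sqrt (by positivity : 0 ≤ 1 + y ^ 2)
    have px := one_le_sqrt_one_add_sq x
    have py := one_le_sqrt_one_add_sq y
    set X := √(1 + x ^ 2)
    set Y := √(1 + y ^ 2)
    -- This is Cauchy–Schwarz for `(1,x)` and `(1,y)`: `√(1 + r²)` is the norm of `(1,r)`, hence
    -- convex.
    have hXY : 1 + x * y ≤ X * Y := by
      refine le_of_sq_le_sq ?_ (by positivity)
      rw [mul_pow, hx, hy]; nlinarith [sq_nonneg (x - y)]
    have : √(1 + (a * x + b * y) ^ 2) ≤ a * X + b * Y := by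
      refine Real.sqrt_le_iff.2 ⟨by positivity, ?_⟩
      have e : (a + b) ^ 2 = 1 := by rw [hab]; norm_num
      have e' : (a * X + b * Y) ^ 2 =
          a ^ 2 * (1 + x ^ 2) + 2 * (a * b * (X * Y)) + b ^ 2 * (1 + y ^ 2) := by
        rw [← hx, ← hy]; ring
      rw [e']
      linarith [mul_le_mul_of_nonneg_left hXY (mul_nonneg ha hb)]
    linarith
  exact h.pow (fun r _ => sub_nonneg.2 (one_le_sqrt_one_add_sq r)) n

lemma profile_tangent (n : ℕ) (a b : ℝ) :
    profile n a + deriv (profile n) a * (b - a) ≤ profile n b := by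
  have hd := ((contDiff_profile n).differentiable one_ne_zero) a
  rcases lt_trichotomy a b with h | h | h
  · have := (convexOn_profile n).deriv_le_slope (mem_univ a) (mem_univ b) h hd
    rw [slope_def_field, le_div_iff₀ (by linarith)] at this
    linarith
  · simp [h]
  · have := (convexOn_profile n).slope_le_deriv (mem_univ b) (mem_univ a) h hd
    rw [slope_def_field, div_le_iff₀ (by linarith)] at this
    linarith

/-- For `|r| ≤ 1` the profile is at most `|r|^(2⌊p⌋)`, and `2⌊p⌋ ≥ p` since `⌊p⌋ ≥ 1`; for `|r| ≥ 1`
it is at most `|r|^⌊p⌋`. Thus a C¹ substitute for `|r|^p` is available even at `p = 1`. -/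
lemma profile_floor_le {p : ℝ} (hp : 1 ≤ p) (r : ℝ) : profile ⌊p⌋₊ r ≤ |r| ^ p := by
  have h0 := sub_nonneg.2 (one_le_sqrt_one_add_sq r)
  have hsq := Real.sq_sqrt (by positivity : 0 ≤ 1 + r ^ 2)
  have hr := sq_abs r
  have ha := abs_nonneg r
  have hfl : (⌊p⌋₊ : ℝ) ≤ p := Nat.floor_le (by linarith)
  have hfl1 : (1 : ℝ) ≤ ⌊p⌋₊ := by exact_mod_cast Nat.le_floor (by simpa using hp)
  have hfl2 := Nat.lt_floor_add_one p
  rcases le_total |r| 1 with h | h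
  · have h1 : √(1 + r ^ 2) - 1 ≤ |r| ^ 2 := by
      nlinarith [one_le_sqrt_one_add_sq r]
    rcases ha.eq_or_lt with h2 | h2
    · have : r = 0 := abs_eq_zero.1 h2.symm
      rw [this, profile_zero (by intro h3; rw [h3] at hfl1; norm_num at hfl1)]
      positivity
    · calc profile ⌊p⌋₊ r ≤ (|r| ^ 2) ^ ⌊p⌋₊ := pow_le_pow_left₀ h0 h1 _
        _ = |r| ^ (2 * ⌊p⌋₊ : ℝ) := by rw [← pow_mul, ← Real.rpow_natCast]; push_cast; rfl
        _ ≤ |r| ^ p := Real.rpow_le_rpow_of_exponent_ge h2 h (by linarith)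
  · have h1 : √(1 + r ^ 2) - 1 ≤ |r| := by
      nlinarith [one_le_sqrt_one_add_sq r]
    calc profile ⌊p⌋₊ r ≤ |r| ^ ⌊p⌋₊ := pow_le_pow_left₀ h0 h1 _
      _ = |r| ^ (⌊p⌋₊ : ℝ) := (Real.rpow_natCast _ _).symm
      _ ≤ |r| ^ p := Real.rpow_le_rpow_of_exponent_le h hfl

end Profile

/-! ### Regularity of solutions -/

section Regularity

variable {N : ℕ} {T : ℝ} {u : Space N → ℝ → ℝ}

/-- The time derivative of `u`, as a function on `ℝ^N × [0,T]`. -/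
def timeDeriv (T : ℝ) (u : Space N → ℝ → ℝ) (z : Space N × ℝ) : ℝ :=
  fderivWithin ℝ (fun z : Space N × ℝ => u z.1 z.2) (univ ×ˢ Icc 0 T) z (0, 1)

lemma uniqueDiffOn_strip (hT : 0 < T) :
    UniqueDiffOn ℝ ((univ : Set (Space N)) ×ˢ Icc 0 T) :=
  uniqueDiffOn_univ.prod (uniqueDiffOn_Icc hT)

lemma continuousOn_timeDeriv (hT : 0 < T)
    (hu : ContDiffOn ℝ 2 (fun z : Space N × ℝ => u z.1 z.2) (univ ×ˢ Icc 0 T)) :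
    ContinuousOn (timeDeriv T u) (univ ×ˢ Icc 0 T) :=
  (hu.continuousOn_fderivWithin (uniqueDiffOn_strip hT) (by norm_num)).clm_apply
    continuousOn_const

lemma hasDerivWithinAt_timeDeriv
    (hu : ContDiffOn ℝ 2 (fun z : Space N × ℝ => u z.1 z.2) (univ ×ˢ Icc 0 T))
    (x : Space N) {t : ℝ} (ht : t ∈ Icc 0 T) :
    HasDerivWithinAt (u x) (timeDeriv T u (x, t)) (Icc 0 T) t := by
  have h1 := (hu.differentiableOn two_ne_zero (x, t) ⟨mem_univ _, ht⟩).hasFDerivWithinAt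
  have h2 : HasDerivWithinAt (fun τ : ℝ => (x, τ)) ((0 : Space N), (1 : ℝ)) (Icc 0 T) t :=
    (hasDerivWithinAt_const t _ x).prodMk (hasDerivWithinAt_id t _)
  exact h1.comp_hasDerivWithinAt t h2 fun τ hτ => ⟨mem_univ _, hτ⟩

lemma derivWithin_eq_timeDeriv
    (hu : ContDiffOn ℝ 2 (fun z : Space N × ℝ => u z.1 z.2) (univ ×ˢ Icc 0 T))
    (x : Space N) {t : ℝ} (ht : t ∈ Ioc 0 T) :
    derivWithin (fun τ => u x τ) (Ioc 0 T) t = timeDeriv T u (x, t) :=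
  ((hasDerivWithinAt_timeDeriv hu x (Ioc_subset_Icc_self ht)).mono
    Ioc_subset_Icc_self).derivWithin (uniqueDiffOn_Ioc 0 T t ht)

lemma contDiff_slice
    (hu : ContDiffOn ℝ 2 (fun z : Space N × ℝ => u z.1 z.2) (univ ×ˢ Icc 0 T))
    {t : ℝ} (ht : t ∈ Icc 0 T) : ContDiff ℝ 2 fun x => u x t := by
  rw [← contDiffOn_univ]
  exact hu.comp (contDiff_id.prodMk contDiff_const).contDiffOn fun x _ => ⟨mem_univ _, ht⟩

/-- The equation, written with the discrete Laplacian and the truncated nonlocal operators. -/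
lemma IsSolutionProblem.tendsto_mixed {s : ℝ} {ρ : Space N → ℝ}
    (hu : IsSolutionProblem s T ρ u) {t : ℝ} (ht : t ∈ Ioc 0 T) (x : Space N) :
    Tendsto (fun h => discreteLaplacian h (fun y => u y t) x -
      fracConst N s * nonlocal (N + 2 * s) h (fun y => u y t) x) (𝓝[>] 0)
      (𝓝 (ρ x * timeDeriv T u (x, t))) := by
  obtain ⟨L, hL, heq⟩ := hu.solution.equation x t ht
  rw [derivWithin_eq_timeDeriv hu.contDiffOn x ht] at heq
  have h1 := tendsto_discreteLaplacian (contDiff_slice hu.contDiffOn (Ioc_subset_Icc_self ht)) x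
  have h2 := hasFracLaplacianAt_iff.1 hL
  convert h1.sub h2 using 2
  linarith

end Regularity

/-! ### Integration in time -/

section Energy

variable {N : ℕ} {T : ℝ} {u : Space N → ℝ → ℝ}

lemma volume_restrict_strip (I : Set ℝ) :
    (volume : Measure (Space N × ℝ)).restrict (univ ×ˢ I) =
      (volume : Measure (Space N)).prod (volume.restrict I) := by
  rw [Measure.volume_eq_prod, ← Measure.prod_restrict, Measure.restrict_univ]

lemma integrable_strip_of_continuousOn {t : ℝ} {W : Space N × ℝ → ℝ} {K : Set (Space N)}
    (hK : IsCompact K) (hW : ContinuousOn W (univ ×ˢ Icc 0 t))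
    (hW0 : ∀ x ∉ K, ∀ τ, W (x, τ) = 0) :
    Integrable W ((volume : Measure (Space N)).prod (volume.restrict (Ioc 0 t))) := by
  rw [← volume_restrict_strip]
  have h1 : IntegrableOn W (K ×ˢ Icc 0 t) :=
    (hW.mono (prod_mono (subset_univ _) Subset.rfl)).integrableOn_compact (hK.prod isCompact_Icc)
  refine IntegrableOn.of_forall_sdiff_eq_zero h1 (MeasurableSet.univ.prod measurableSet_Ioc) ?_
  rintro ⟨x, τ⟩ ⟨⟨-, h2⟩, h3⟩
  exact hW0 x (fun hx => h3 ⟨hx, Ioc_subset_Icc_self h2⟩) τ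

/-- Duhamel's identity for a weighted integral of `G(u)`. -/
lemma exp_mul_integral_eq (hT : 0 < T)
    (hu : ContDiffOn ℝ 2 (fun z : Space N × ℝ => u z.1 z.2) (univ ×ˢ Icc 0 T))
    (hu0 : ∀ x, u x 0 = 0) {G : ℝ → ℝ} (hG : ContDiff ℝ 1 G) (hG0 : G 0 = 0)
    {w : Space N → ℝ} (hw : Continuous w) (hwc : HasCompactSupport w) (lam : ℝ) {t : ℝ}
    (ht : t ∈ Ioc 0 T) :
    Integrable (fun τ => Real.exp (-lam * τ) * ∫ x, w x * (deriv G (u x τ) *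
        timeDeriv T u (x, τ) - lam * G (u x τ))) (volume.restrict (Ioc 0 t)) ∧
      Real.exp (-lam * t) * ∫ x, w x * G (u x t) =
        ∫ τ in Ioc 0 t, Real.exp (-lam * τ) * ∫ x, w x * (deriv G (u x τ) *
          timeDeriv T u (x, τ) - lam * G (u x τ)) := by
  have hGd := hG.continuous_deriv le_rfl
  have hsub : (univ : Set (Space N)) ×ˢ Icc 0 t ⊆ univ ×ˢ Icc 0 T :=
    prod_mono Subset.rfl (Icc_subset_Icc le_rfl ht.2)
  have hV := (continuousOn_timeDeriv hT hu).mono hsub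
  have hU : ContinuousOn (fun z : Space N × ℝ => u z.1 z.2) (univ ×ˢ Icc 0 t) :=
    hu.continuousOn.mono hsub
  -- `Q` is the time derivative of `exp(-λτ) G(u(x,τ))`. The identity is the fundamental theorem of
  -- calculus at each `x`, with no contribution at time 0, followed by Fubini on a compact set.
  set Q : Space N × ℝ → ℝ := fun z => Real.exp (-lam * z.2) *
    (deriv G (u z.1 z.2) * timeDeriv T u z - lam * G (u z.1 z.2)) with hQ
  have hQc : ContinuousOn Q (univ ×ˢ Icc 0 t) := by
    have c1 := hGd.comp_continuousOn hU
    have c2 := hG.continuous.comp_continuousOn hU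
    have c3 : ContinuousOn (fun z : Space N × ℝ => Real.exp (-lam * z.2)) (univ ×ˢ Icc 0 t) := by
      fun_prop
    exact c3.mul ((c1.mul hV).sub (continuousOn_const.mul c2))
  have hWc : ContinuousOn (fun z : Space N × ℝ => w z.1 * Q z) (univ ×ˢ Icc 0 t) :=
    (hw.comp continuous_fst).continuousOn.mul hQc
  have hWi := integrable_strip_of_continuousOn hwc.isCompact hWc fun x hx τ => by
    simp [image_eq_zero_of_notMem_tsupport hx]
  have e1 : ∀ τ, ∫ x, w x * Q (x, τ) = Real.exp (-lam * τ) * ∫ x, w x * (deriv G (u x τ) *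
      timeDeriv T u (x, τ) - lam * G (u x τ)) := by
    intro τ
    rw [← integral_const_mul]
    congr 1; ext x; simp only [hQ]; ring
  have e2 : ∀ x, ∫ τ in Ioc 0 t, w x * Q (x, τ) = w x * (Real.exp (-lam * t) * G (u x t)) := by
    intro x
    rw [integral_const_mul]
    congr 1
    have hcx : ContinuousOn (fun τ => Q (x, τ)) (Icc 0 t) :=
      hQc.comp (by fun_prop) fun τ hτ => ⟨mem_univ _, hτ⟩
    have hux : ContinuousOn (fun τ => u x τ) (Icc 0 t) :=
      hU.comp (f := fun τ : ℝ => (x, τ)) (by fun_prop) fun τ hτ => ⟨mem_univ _, hτ⟩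
    have hftc := intervalIntegral.integral_eq_sub_of_hasDerivAt_of_le ht.1.le
      (f := fun τ => Real.exp (-lam * τ) * G (u x τ)) (f' := fun τ => Q (x, τ)) ?_ ?_ ?_
    · rw [intervalIntegral.integral_of_le ht.1.le] at hftc
      rw [hftc, hu0, hG0]; ring
    · exact ContinuousOn.mul (by fun_prop) (hG.continuous.comp_continuousOn hux)
    · intro τ hτ
      have hτT : Icc 0 T ∈ 𝓝 τ := Icc_mem_nhds hτ.1 (hτ.2.trans_le ht.2)
      have d1 := (hasDerivWithinAt_timeDeriv hu x (mem_of_mem_nhds hτT)).hasDerivAt hτT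
      have d2 := ((hG.differentiable one_ne_zero) (u x τ)).hasDerivAt.comp τ d1
      have d3 : HasDerivAt (fun τ => Real.exp (-lam * τ)) (Real.exp (-lam * τ) * (-lam)) τ := by
        simpa using ((hasDerivAt_id τ).const_mul (-lam)).exp
      refine (d3.mul d2).congr_deriv ?_
      simp only [hQ, Function.comp_apply]; ring
    · exact (hcx.mono (by rw [uIcc_of_le ht.1.le])).intervalIntegrable
  constructor
  · simpa only [e1] using hWi.integral_prod_right
  · have := integral_integral_swap (f := fun x τ => w x * Q (x, τ)) hWi
    simp only [e1, e2] at this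
    rw [← this, ← integral_const_mul]
    congr 1; ext x; ring

end Energy

/-! ### Uniqueness -/

section Uniqueness

variable {N : ℕ} {T : ℝ} {u : Space N → ℝ → ℝ}

lemma MemLpPsi.integrable {p β : ℝ} (h : MemLpPsi p β T u) :
    Integrable (fun z : Space N × ℝ => |u z.1 z.2| ^ p * psi β z.1)
      ((volume : Measure (Space N)).prod (volume.restrict (Ioc 0 T))) := by
  obtain ⟨hm, hfin⟩ := h
  have hnn : ∀ z : Space N × ℝ, 0 ≤ |u z.1 z.2| ^ p * psi β z.1 := fun z =>
    mul_nonneg (Real.rpow_nonneg (abs_nonneg _) p) (psi_pos β z.1).le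
  rw [← volume_restrict_strip]
  refine ⟨?_, ?_⟩
  · have h1 : AEStronglyMeasurable (fun z : Space N × ℝ => |u z.1 z.2| ^ p)
        (volume.restrict (univ ×ˢ Ioc 0 T)) :=
      (hm.norm.aemeasurable.pow_const p).aestronglyMeasurable
    exact h1.mul ((continuous_psi β).comp continuous_fst).aestronglyMeasurable
  · exact (hasFiniteIntegral_iff_ofReal (ae_of_all _ hnn)).2 hfin

lemma MemLpPsi.mono {p β β' : ℝ} (h : MemLpPsi p β T u) (hβ : β ≤ β') : MemLpPsi p β' T u :=
  ⟨h.1, lt_of_le_of_lt (lintegral_mono fun z => ENNReal.ofReal_le_ofReal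
    (mul_le_mul_of_nonneg_left (psi_le_psi_of_exponent_le hβ z.1) (by positivity))) h.2⟩

lemma AssumptionH0.pos {ρ : Space N → ℝ} {α C₀ : ℝ} (h : AssumptionH0 ρ α C₀) (x : Space N) :
    0 < ρ x :=
  lt_of_lt_of_le (mul_pos h.const_pos (by positivity)) (h.lower_bound x)

/-- The weighted integral of the convex profile of a solution is controlled by the error made by
the cut-off. -/
lemma energy_le (hN : 1 ≤ N) {s : ℝ} (hs : s ∈ Ioo (0 : ℝ) 1) (hT : 0 < T) {ρ : Space N → ℝ}
    {α C₀ : ℝ} (hρ : AssumptionH0 ρ α C₀) {β : ℝ} {p : ℝ}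
    (hp : 1 ≤ p) (hu : IsSolutionProblem s T ρ u)
    (hup : ∀ t ∈ Ioc 0 T, MemLs s fun x => |u x t| ^ p) {C R : ℝ} (hC : 0 ≤ C) (hR : 1 ≤ R)
    (hint : Integrable (fun z : Space N × ℝ => |u z.1 z.2| ^ p * testError (N + 2 * s) β C R z.1)
      ((volume : Measure (Space N)).prod (volume.restrict (Ioc 0 T))))
    (htest : ∀ h, 0 < h → h ≤ 1 / 2 → ∀ x : Space N,
      discreteLaplacian h (testFun R β) x - fracConst N s *
        nonlocal (N + 2 * s) h (testFun R β) x ≤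
          C * bracket x ^ (-α) * testFun R β x + testError (N + 2 * s) β C R x)
    {t : ℝ} (ht : t ∈ Ioc 0 T) :
    Real.exp (-(C / C₀) * t) * ∫ x, ρ x * testFun R β x * profile ⌊p⌋₊ (u x t) ≤
      ∫ z, |u z.1 z.2| ^ p * testError (N + 2 * s) β C R z.1
        ∂((volume : Measure (Space N)).prod (volume.restrict (Ioc 0 T))) := by
  have hs0 := hs.1
  have hR0 : 0 < R := by linarith
  have hν : (N : ℝ) < N + 2 * s := by linarith
  have hν' : (N : ℝ) + 2 * s < N + 2 := by linarith [hs.2]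
  -- With this rate, `C ⟨x⟩^(-α) ≤ λ ρ(x)` by the lower bound on `ρ`.
  set lam := C / C₀ with hlam
  have hlam0 : 0 ≤ lam := div_nonneg hC hρ.const_pos.le
  set G := profile ⌊p⌋₊ with hG
  have hGcd : ContDiff ℝ 1 G := contDiff_profile _
  have hG0 : G 0 = 0 := profile_zero (Nat.floor_pos.2 hp).ne'
  have hGp : ∀ r, G r ≤ |r| ^ p := profile_floor_le hp
  have hGn : ∀ r, 0 ≤ G r := profile_nonneg _
  have hφ := continuous_testFun (N := N) R β
  have hφc := hasCompactSupport_testFun (N := N) hR0 β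
  have hw : Continuous fun x => ρ x * testFun R β x := hρ.continuous.mul hφ
  have hwc : HasCompactSupport fun x => ρ x * testFun R β x := hφc.mul_left
  set E := fun τ => ∫ x, |u x τ| ^ p * testError (N + 2 * s) β C R x with hE
  have hEn : ∀ τ, 0 ≤ E τ := fun τ => integral_nonneg fun x =>
    mul_nonneg (by positivity) (testError_nonneg hC hR0.le _ _ x)
  -- The differential inequality is asserted only at times where the error is integrable in `x`;
  -- joint integrability gives almost every time, which suffices after integration.
  have hslice : ∀ τ ∈ Ioc 0 T,
      Integrable (fun x => |u x τ| ^ p * testError (N + 2 * s) β C R x) →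
      ∫ x, ρ x * testFun R β x * (deriv G (u x τ) * timeDeriv T u (x, τ) - lam * G (u x τ)) ≤
        E τ := by
    intro τ hτ hi
    have hf := contDiff_slice hu.contDiffOn (Ioc_subset_Icc_self hτ)
    have hft := (hu.solution.memLs τ hτ).tailIntegrable hs0.le
    have hGt : TailIntegrable (N + 2 * s) (G ∘ fun x => u x τ) :=
      ((hup τ hτ).tailIntegrable hs0.le).mono
        (hGcd.continuous.comp hf.continuous).aestronglyMeasurable fun y => by
          rw [Function.comp_apply, abs_of_nonneg (hGn _)]
          exact (hGp _).trans (le_abs_self _)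
    have hGi : Integrable fun x => G (u x τ) * testError (N + 2 * s) β C R x := by
      refine hi.mono' ((hGcd.continuous.comp hf.continuous).aestronglyMeasurable.mul
        (measurable_testError _ _ _ _).aestronglyMeasurable) (ae_of_all _ fun x => ?_)
      have := testError_nonneg hC hR0.le (N + 2 * s) β x
      rw [Real.norm_of_nonneg (mul_nonneg (hGn _) this)]
      exact mul_le_mul_of_nonneg_right (hGp _) this
    have hφG : Integrable fun x => ρ x * testFun R β x * G (u x τ) :=
      (hw.mul (hGcd.continuous.comp hf.continuous)).integrable_of_hasCompactSupport hwc.mul_right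
    have hVc : Continuous fun x => timeDeriv T u (x, τ) := by
      rw [← continuousOn_univ]
      exact (continuousOn_timeDeriv hT hu.contDiffOn).comp (f := fun x : Space N => (x, τ))
        (by fun_prop) fun x _ => ⟨mem_univ _, Ioc_subset_Icc_self hτ⟩
    have hφV : Integrable fun x => testFun R β x * deriv G (u x τ) *
        (ρ x * timeDeriv T u (x, τ)) :=
      ((hφ.mul ((hGcd.continuous_deriv le_rfl).comp hf.continuous)).mul
        (hρ.continuous.mul hVc)).integrable_of_hasCompactSupport hφc.mul_right.mul_right
    have key := integral_test_le hN hν hν' (fracConst_nonneg hs) (profile_tangent ⌊p⌋₊) hGn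
      hGcd.continuous (hGcd.continuous_deriv le_rfl) hf hft hGt (hu.tendsto_mixed hτ) hφ hφc
      (testFun_nonneg R β)
      (Φ := fun x => lam * (ρ x * testFun R β x) + testError (N + 2 * s) β C R x)
      (fun h h0 h1 x => ?_) ?_
    · have e1 : ∫ x, ρ x * testFun R β x * (deriv G (u x τ) * timeDeriv T u (x, τ) -
          lam * G (u x τ)) = (∫ x, testFun R β x * deriv G (u x τ) *
          (ρ x * timeDeriv T u (x, τ))) - lam * ∫ x, ρ x * testFun R β x * G (u x τ) := by
        rw [← integral_const_mul, ← integral_sub hφV (hφG.const_mul lam)]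
        congr 1; ext x; ring
      have e2 : ∫ x, G (u x τ) * (lam * (ρ x * testFun R β x) +
          testError (N + 2 * s) β C R x) = lam * (∫ x, ρ x * testFun R β x * G (u x τ)) +
          ∫ x, G (u x τ) * testError (N + 2 * s) β C R x := by
        rw [← integral_const_mul, ← integral_add (hφG.const_mul lam) hGi]
        congr 1; ext x; ring
      have e3 : ∫ x, G (u x τ) * testError (N + 2 * s) β C R x ≤ E τ :=
        integral_mono hGi hi fun x => mul_le_mul_of_nonneg_right (hGp _)
          (testError_nonneg hC hR0.le _ _ x)
      rw [e1]
      rw [e2] at key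
      linarith
    · refine (htest h h0 h1 x).trans (add_le_add_left ?_ _)
      rw [← mul_assoc]
      refine mul_le_mul_of_nonneg_right ?_ (testFun_nonneg R β x)
      have h2 := hρ.lower_bound x
      have h3 := psi_eq_bracket α x
      rw [psi] at h3
      rw [h3] at h2
      calc C * bracket x ^ (-α) = lam * (C₀ * bracket x ^ (-α)) := by
            rw [hlam, ← mul_assoc, div_mul_cancel₀ _ hρ.const_pos.ne']
        _ ≤ lam * ρ x := by gcongr
    · refine ((hφG.const_mul lam).add hGi).congr (ae_of_all _ fun x => ?_)
      simp only [Pi.add_apply]; ring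
  obtain ⟨hi1, heq⟩ := exp_mul_integral_eq hT hu.contDiffOn hu.initial hGcd hG0 hw hwc lam ht
  have hEi : Integrable E (volume.restrict (Ioc 0 T)) := hint.integral_prod_right
  have hae : ∀ᵐ τ ∂(volume.restrict (Ioc 0 T)),
      Integrable fun x => |u x τ| ^ p * testError (N + 2 * s) β C R x := hint.prod_left_ae
  have hsub : Ioc 0 t ⊆ Ioc 0 T := Ioc_subset_Ioc_right ht.2
  rw [heq, integral_prod_symm _ hint]
  calc _ ≤ ∫ τ in Ioc 0 t, E τ := by
        refine integral_mono_ae hi1 (hEi.mono_measure (Measure.restrict_mono hsub le_rfl)) ?_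
        filter_upwards [ae_mono (Measure.restrict_mono hsub le_rfl) hae,
          ae_restrict_mem measurableSet_Ioc] with τ h1 h2
        have h3 := hslice τ (hsub h2) h1
        have h4 : Real.exp (-lam * τ) ≤ 1 := Real.exp_le_one_iff.2 (by nlinarith [h2.1])
        calc _ ≤ Real.exp (-lam * τ) * E τ := by gcongr
          _ ≤ E τ := mul_le_of_le_one_left (hEn τ) h4
    _ ≤ ∫ τ in Ioc 0 T, E τ :=
        setIntegral_mono_set hEi (ae_of_all _ hEn) hsub.eventuallyLE

/-- Uniqueness, given a lower bound for the truncated operators applied to the weight. -/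
theorem eq_zero_of_nonlocal_psi_bound (hN : 1 ≤ N) {s : ℝ} (hs : s ∈ Ioo (0 : ℝ) 1) (hT : 0 < T)
    {ρ : Space N → ℝ} {α C₀ : ℝ} (hρ : AssumptionH0 ρ α C₀) (hα : α ≤ 2) {β : ℝ} (hβ : 0 ≤ β)
    (hβν : β ≤ N + 2 * s) {K : ℝ} (hK0 : 0 ≤ K)
    (hK : ∀ ε, 0 < ε → ∀ x : Space N,
      -nonlocal (N + 2 * s) ε (psi β) x ≤ K * bracket x ^ (-α) * psi β x)
    {p : ℝ} (hp : 1 ≤ p) (hu : IsSolutionProblem s T ρ u)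
    (hup : ∀ t ∈ Ioc 0 T, MemLs s fun x => |u x t| ^ p) (huψ : MemLpPsi p β T u) :
    ∀ x, ∀ t ∈ Ioc 0 T, u x t = 0 := by
  have hs0 := hs.1
  have hν : (N : ℝ) < N + 2 * s := by linarith
  have hν' : (N : ℝ) + 2 * s < N + 2 := by linarith [hs.2]
  obtain ⟨C, hC, htest⟩ := exists_mixed_testFun_le hN hν hν' hβ hα (fracConst_nonneg (N := N) hs)
    hK0 hK
  obtain ⟨B, hB, hBe⟩ := exists_testError_le (N := N) hν hβ hβν hC
  have hI := huψ.integrable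
  set μ := (volume : Measure (Space N)).prod (volume.restrict (Ioc 0 T)) with hμ
  have hm1 : AEStronglyMeasurable (fun z : Space N × ℝ => |u z.1 z.2| ^ p) μ := by
    rw [hμ, ← volume_restrict_strip]
    exact (huψ.1.norm.aemeasurable.pow_const p).aestronglyMeasurable
  have hmeas : ∀ R, AEStronglyMeasurable
      (fun z : Space N × ℝ => |u z.1 z.2| ^ p * testError (N + 2 * s) β C R z.1) μ := fun R =>
    hm1.mul ((measurable_testError _ _ _ _).comp measurable_fst).aestronglyMeasurable
  have hbound : ∀ R, 1 ≤ R → ∀ z : Space N × ℝ,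
      ‖|u z.1 z.2| ^ p * testError (N + 2 * s) β C R z.1‖ ≤
        B * (|u z.1 z.2| ^ p * psi β z.1) := by
    intro R hR z
    have h0 := testError_nonneg hC (by linarith : 0 ≤ R) (N + 2 * s) β z.1
    have hp0 : 0 ≤ |u z.1 z.2| ^ p := by positivity
    rw [Real.norm_of_nonneg (mul_nonneg hp0 h0)]
    calc _ ≤ |u z.1 z.2| ^ p * (B * psi β z.1) := by gcongr; exact hBe R hR z.1
      _ = _ := by ring
  have hlim : Tendsto (fun n : ℕ => ∫ z, |u z.1 z.2| ^ p *
      testError (N + 2 * s) β C ((n : ℝ) + 1) z.1 ∂μ) atTop (𝓝 0) := by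
    have := tendsto_integral_of_dominated_convergence
      (F := fun (n : ℕ) (z : Space N × ℝ) => |u z.1 z.2| ^ p *
        testError (N + 2 * s) β C ((n : ℝ) + 1) z.1) (f := fun _ => 0) _
      (fun n => hmeas ((n : ℝ) + 1)) (hI.const_mul B)
      (fun n => ae_of_all _ (hbound ((n : ℝ) + 1) (by linarith [Nat.cast_nonneg (α := ℝ) n])))
      (ae_of_all _ fun z => by
        simpa using (tendsto_testError hν hβ C z.1).const_mul (|u z.1 z.2| ^ p))
    rw [integral_zero] at this
    exact this
  intro x t ht
  have huc := (contDiff_slice hu.contDiffOn (Ioc_subset_Icc_self ht)).continuous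
  set G := profile ⌊p⌋₊ with hG
  have hGc : Continuous G := (contDiff_profile _).continuous
  have hGn : ∀ r, 0 ≤ G r := profile_nonneg _
  have hcont : ∀ R, Continuous fun y => ρ y * testFun R β y * G (u y t) := fun R =>
    (hρ.continuous.mul (continuous_testFun R β)).mul (hGc.comp huc)
  have hcomp : ∀ R, 0 < R → HasCompactSupport fun y => ρ y * testFun R β y * G (u y t) :=
    fun R hR => (hasCompactSupport_testFun hR β).mul_left.mul_right
  have hnn : ∀ R y, 0 ≤ ρ y * testFun R β y * G (u y t) := fun R y =>
    mul_nonneg (mul_nonneg (hρ.pos y).le (testFun_nonneg R β y)) (hGn _)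
  -- A fixed cut-off equal to 1 at `x`: it lies below all sufficiently large ones, so its energy is
  -- at most the vanishing error, while `u x t ≠ 0` would make that energy positive.
  set R₀ := ‖x‖ + 1 with hR₀
  have hR₀pos : 0 < R₀ := by positivity
  have hle : ∀ᶠ n : ℕ in atTop,
      Real.exp (-(C / C₀) * t) * ∫ y, ρ y * testFun R₀ β y * G (u y t) ≤
        ∫ z, |u z.1 z.2| ^ p * testError (N + 2 * s) β C ((n : ℝ) + 1) z.1 ∂μ := by
    filter_upwards [eventually_ge_atTop ⌈2 * R₀⌉₊] with n hn
    have hn1 : 2 * R₀ ≤ (n : ℝ) + 1 := (Nat.ceil_le.1 hn).trans (by linarith)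
    have hn0 : (1 : ℝ) ≤ (n : ℝ) + 1 := by linarith [Nat.cast_nonneg (α := ℝ) n]
    refine le_trans ?_ (energy_le hN hs hT hρ hp hu hup hC hn0
      ((hI.const_mul B).mono' (hmeas _) (ae_of_all _ (hbound _ hn0))) (htest _ hn0) ht)
    refine mul_le_mul_of_nonneg_left (integral_mono
      ((hcont R₀).integrable_of_hasCompactSupport (hcomp R₀ hR₀pos))
      ((hcont _).integrable_of_hasCompactSupport (hcomp _ (by linarith))) fun y => ?_)
      (Real.exp_pos _).le
    have h1 := cutoff_le_cutoff hR₀pos hn1 y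
    have h2 := (psi_pos β y).le
    have h3 := (hρ.pos y).le
    have h4 := hGn (u y t)
    simp only [testFun]
    gcongr
  have hzero : Real.exp (-(C / C₀) * t) * ∫ y, ρ y * testFun R₀ β y * G (u y t) ≤ 0 :=
    ge_of_tendsto hlim hle
  by_contra hne
  have hx : ρ x * testFun R₀ β x * G (u x t) ≠ 0 := by
    refine mul_ne_zero (mul_ne_zero (hρ.pos x).ne' ?_) fun h => hne (eq_zero_of_profile_eq_zero h)
    rw [testFun, cutoff_eq_one hR₀pos (by rw [hR₀]; linarith), one_mul]
    exact (psi_pos β x).ne'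
  have := (hcont R₀).integral_pos_of_hasCompactSupport_nonneg_nonzero (μ := volume)
    (hcomp R₀ hR₀pos) (hnn R₀) hx
  exact absurd hzero (not_le.2 (mul_pos (Real.exp_pos _) this))

end Uniqueness

end MixedParabolic

end

/-! ### The four exponent regimes -/

theorem theorem5p3 (N : ℕ) (hN : 1 ≤ N) (s : ℝ) (hs : s ∈ Set.Ioo (0 : ℝ) 1)
    (T : ℝ) (hT : 0 < T) (ρ : MixedParabolic.Space N → ℝ) (α C₀ : ℝ)
    (hρ : MixedParabolic.AssumptionH0 ρ α C₀)
    (β : ℝ) (hβ : 0 < β) (hcond : MixedParabolic.ExponentCondition N s α β)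
    (p : ℝ) (hp : 1 ≤ p) (u : MixedParabolic.Space N → ℝ → ℝ)
    (hu : MixedParabolic.IsSolutionProblem s T ρ u)
    (hup : ∀ t ∈ Set.Ioc 0 T, MixedParabolic.MemLs s (fun x => |u x t| ^ p))
    (huψ : MixedParabolic.MemLpPsi p β T u) :
    ∀ x, ∀ t ∈ Set.Ioc 0 T, u x t = 0 := by
  have hs0 := hs.1
  have hs1 := hs.2
  have hα := hρ.alpha_nonneg
  have hν : (N : ℝ) < N + 2 * s := by linarith
  have hν' : (N : ℝ) + 2 * s < N + 2 := by linarith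
  rcases hcond with ⟨-, h1, h2⟩ | ⟨h1, h2, h3⟩ | ⟨h1, h2⟩ | ⟨h1, h2⟩
  -- Raising `β` to `N - 2s` shrinks the weight, so the integrability of `u` persists. At this
  -- exponent the weight is superharmonic and `K = 0`, so `α` is restricted only by the local part.
  · refine MixedParabolic.eq_zero_of_nonlocal_psi_bound hN hs hT hρ h2 (β := N - 2 * s)
      (by linarith) (by linarith) le_rfl (fun ε hε x => ?_) hp hu hup (huψ.mono h1)
    have := MixedParabolic.nonlocal_psi_critical_nonneg hN hν (β := N - 2 * s) (by linarith)
      (by ring) hε x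
    simpa using this
  · obtain ⟨K, hK0, hK⟩ := MixedParabolic.exists_neg_nonlocal_psi_le_of_lt_dim hN hν hν' hβ h2
      (α := α) (by linarith)
    exact MixedParabolic.eq_zero_of_nonlocal_psi_bound hN hs hT hρ (by linarith) hβ.le
      (by linarith) hK0 hK hp hu hup huψ
  -- The weight is replaced by the one with exponent `N + 2s - α`, the largest admissible one; it
  -- exceeds `N` precisely because `α < 2s`.
  · obtain ⟨K, hK0, hK⟩ := MixedParabolic.exists_neg_nonlocal_psi_le_of_dim_lt hN hν'
      (β := N + 2 * s - α) (by linarith) hα (by linarith)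
    exact MixedParabolic.eq_zero_of_nonlocal_psi_bound hN hs hT hρ (by linarith) (by linarith)
      (by linarith) hK0 hK hp hu hup (huψ.mono (by linarith))
  · obtain ⟨K, hK0, hK⟩ := MixedParabolic.exists_neg_nonlocal_psi_le_of_dim_lt hN hν' h1 hα
      (by linarith)
    exact MixedParabolic.eq_zero_of_nonlocal_psi_bound hN hs hT hρ (by linarith) hβ.le
      (by linarith) hK0 hK hp hu hup huψ
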